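/- **Setting.** Let $I$ be a nonempty directed set and $1\le p<\infty$. A *measure space* here is a locally compact Polish space with a positive Radon (i.e. locally finite Borel) measure of full support. Let $M_i$ $(i\in I)$ and $M$ be measure spaces. A *measure approximation* is a net of measurable maps $\varphi_i:\operatorname{Dom}(\varphi_i)\to M$ on Borel sets $\operatorname{Dom}(\varphi_i)\subset M_i$ such that for every $f\in C_c(M)$ the function $f\circ\varphi_i$ is integrable for all sufficiently large $i$, and $\int_{\operatorname{Dom}(\varphi_i)}f\circ\varphi_i\to\int_M f$. Two measure approximations $\{\varphi_i\},\{\psi_i\}$ are *equivalent* if for every compact $C\subset M$: (a) for every $\epsilon>0$, for all sufficiently large $i$ and all $x\in\operatorname{Dom}(\varphi_i)\cap\operatorname{Dom}(\psi_i)\cap(\varphi_i^{-1}(C)\cup\psi_i^{-1}(C))$ one has $d_M(\varphi_i(x),\psi_i(x))<\epsilon$, where $d_M$ is a metric compatible with the topology of $M$; and (b) the measures of $\varphi_i^{-1}(C)\setminus\operatorname{Dom}(\psi_i)$ and of $\psi_i^{-1}(C)\setminus\operatorname{Dom}(\varphi_i)$ tend to $0$. For a metric space $Y$ and a measurable map $\xi:M\to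 Y$, let $L^p_\xi(M,Y)$ be the metric space of a.e. classes of measurable maps $u:M\to Y$ with $d_{L^p}(u,\xi)<\infty$, where $d_{L^p}(u,v)=(\int_M d_Y(u,v)^p)^{1/p}$. For a net of metric spaces $X_i$ and a metric space $X$, an *asymptotic relation* is a topology on $\mathcal X=(\bigsqcup_iX_i)\sqcup X$ such that: (A1) each $X_i$ and $X$ is closed in $\mathcal X$ and carries its original topology as a subspace; (A2) every $x\in X$ is the limit of a net $x_i\in X_i$; (A3) if $X_i\ni x_i\to x\in X$ and $X_i\ni y_i\to y\in X$, then $d(x_i,y_i)\to d(x,y)$; (A4) if $X_i\ni x_i\to x\in X$ and $y_i\in X_i$, $d(x_i,y_i)\to0$, then $y_i\to x$. If $X_i$, $X$ are real topological vector spaces, it is *linear* if $x_i\to x$, $y_i\to y$ imply $ax_i+by_i\to ax+by$ for all $a,b\in\mathbb R$. *Banach targets.* Let $\mathbb B$ be a separable real Banach space. For a continuous compactly supported $w:M\to\mathbb B$ let $\Phi_iw=w\circ\varphi_i$ on $\operatorname{Dom}(\varphi_i)$ and $\Phi_iw=0$ elsewhere on $M_i$. Say that $v_i\in L^p(M_i,\mathbb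 B)$ converges to $v\in L^p(M,\mathbb B)$ if there are $w_j\in C_c(M,\mathbb B)$, $j\in\mathbb N$, with $w_j\to v$ in $L^p$ and $\lim_j\limsup_i\|v_i-\Phi_iw_j\|_{L^p}=0$. The *$L^p$-topology* on $(\bigsqcup_iL^p(M_i,\mathbb B))\sqcup L^p(M,\mathbb B)$ is the topology induced by this convergence, i.e. the finest one in which all these convergences hold and the inclusions of the pieces are continuous. *Targets.* Let $(Y_i,y_i)$ and $(Y,y_0)$ be pointed proper metric spaces and let $\{\psi_i\}$ be a pointed Gromov–Hausdorff approximation: there are positive reals $\epsilon_i\to0$ and $r_i'>r_i\to\infty$ such that $\psi_i:B(y_i,r_i')\to B(y_0,r_i)$ has distortion $<\epsilon_i$, $\epsilon_i$-dense image, and $\psi_i(y_i)=y_0$. A *realizing embedding* into a separable real Banach space $\mathbb B$ consists of isometric embeddings $\alpha_i:Y_i\to\mathbb B$ and $\alpha:Y\to\mathbb B$ with $\sup_{B(y_i,R)}\|\alpha_i-\alpha\circ\psi_i\|\to0$ for every $R>0$. Let $\xi_i:M_i\to Y_i$ be measurable and $\xi:M\to Y$ continuous with $$\lim_i\int_{\operatorname{Dom}(\varphi_i)}\|\alpha_i\xi_i(x)-\alpha\xi\varphi_i(x)\|^p\,dx=0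 .$$ The *$L^p$-topology* on $\mathcal X=(\bigsqcup_iL^p_{\xi_i}(M_i,Y_i))\sqcup L^p_\xi(M,Y)$ is the restriction of that of $(\bigsqcup_iL^p(M_i,\mathbb B))\sqcup L^p(M,\mathbb B)$ under the embeddings $u\mapsto\alpha_i\circ u-\alpha_i\circ\xi_i$ and $u\mapsto\alpha\circ u-\alpha\circ\xi$. **Theorem.** The $L^p$-topology on $\mathcal X$ 1. does not change when $\{\varphi_i\}$ is replaced by an equivalent measure approximation; 2. does not change when $\mathbb B$ and the embedding are replaced by another separable real Banach space and another embedding realizing $\{\psi_i\}$; 3. is an asymptotic relation. Moreover, $\mathcal X$ is closed in $(\bigsqcup_iL^p(M_i,\mathbb B))\sqcup L^p(M,\mathbb B)$. If $Y_i$ and $Y$ are real Banach spaces and $\xi_i$, $\xi$ are the constant maps to their origins, then the $L^p$-topology is a linear asymptotic relation. -/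

import Mathlib

open MeasureTheory Filter Topology Set
open scoped ENNReal CompactlySupported

namespace AsympLp

/-! ### Topologies on a disjoint union and asymptotic relations -/

section Union

/-- The disjoint union of the members `X i` of a net of spaces and of a limit space `Xl`.  It is a
type of its own, so that it carries no preferred topology. -/
inductive AsympUnion {I : Type*} (X : I → Type*) (Xl : Type*)
  | stage (i : I) (x : X i) : AsympUnion X Xl
  | lim (x : Xl) : AsympUnion X Xl

variable {I : Type*} {X X' : I → Type*} {Xl Xl' : Type*}

/-- The map between disjoint unions given by maps between the pieces. -/
def AsympUnion.map (f : ∀ i, X i → X' i) (g : Xl → Xl') : AsympUnion X Xl → AsympUnion X' Xl'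
  | .stage i x => .stage i (f i x)
  | .lim x => .lim (g x)

/-- `x i → x` in the disjoint union with respect to the topology `t`. -/
def ConvergesIn [Preorder I] (t : TopologicalSpace (AsympUnion X Xl)) (x : ∀ i, X i) (xl : Xl) :
    Prop :=
  Tendsto (fun i => (AsympUnion.stage i (x i) : AsympUnion X Xl)) atTop (@nhds _ t (.lim xl))

/-- Asymptotic relations between `X i` and `Xl`: conditions (A1) -- (A4). -/
structure IsAsymptoticRelation [Preorder I] [∀ i, MetricSpace (X i)] [MetricSpace Xl]
    (t : TopologicalSpace (AsympUnion X Xl)) : Prop where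
  isClosed_stage : ∀ i, IsClosed[t] (range (AsympUnion.stage i : X i → AsympUnion X Xl))
  isClosed_lim : IsClosed[t] (range (AsympUnion.lim : Xl → AsympUnion X Xl))
  induced_stage : ∀ i, t.induced (AsympUnion.stage i : X i → AsympUnion X Xl) =
    (inferInstance : TopologicalSpace (X i))
  induced_lim : t.induced (AsympUnion.lim : Xl → AsympUnion X Xl) =
    (inferInstance : TopologicalSpace Xl)
  exists_converges : ∀ xl : Xl, ∃ x : ∀ i, X i, ConvergesIn t x xl
  tendsto_dist : ∀ (x y : ∀ i, X i) (xl yl : Xl), ConvergesIn t x xl → ConvergesIn t y yl →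
    Tendsto (fun i => dist (x i) (y i)) atTop (𝓝 (dist xl yl))
  converges_of_dist : ∀ (x y : ∀ i, X i) (xl : Xl), ConvergesIn t x xl →
    Tendsto (fun i => dist (x i) (y i)) atTop (𝓝 0) → ConvergesIn t y xl

/-- Linear asymptotic relations between topological vector spaces over `ℝ`. -/
structure IsLinearAsymptoticRelation [Preorder I]
    [∀ i, MetricSpace (X i)] [∀ i, AddCommGroup (X i)] [∀ i, Module ℝ (X i)]
    [∀ i, IsTopologicalAddGroup (X i)] [∀ i, ContinuousSMul ℝ (X i)]
    [MetricSpace Xl] [AddCommGroup Xl] [Module ℝ Xl]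
    [IsTopologicalAddGroup Xl] [ContinuousSMul ℝ Xl]
    (t : TopologicalSpace (AsympUnion X Xl)) : Prop extends IsAsymptoticRelation t where
  converges_linear : ∀ (a b : ℝ) (x y : ∀ i, X i) (xl yl : Xl),
    ConvergesIn t x xl → ConvergesIn t y yl →
      ConvergesIn t (fun i => a • x i + b • y i) (a • xl + b • yl)

/-- The topology on the disjoint union induced by a notion `conv` of convergence of nets
`x i ∈ X i` to points of `Xl`, together with the given topologies of the pieces: the finest topology
for which the inclusions of the pieces are continuous and `conv x xl` implies `x i → xl`. -/
@[reducible] def convTopology [Preorder I] [∀ i, TopologicalSpace (X i)] [TopologicalSpace Xl]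
    (conv : (∀ i, X i) → Xl → Prop) : TopologicalSpace (AsympUnion X Xl) where
  IsOpen U := (∀ i, IsOpen {x : X i | AsympUnion.stage i x ∈ U}) ∧
    IsOpen {x : Xl | AsympUnion.lim x ∈ U} ∧
    ∀ x xl, conv x xl → AsympUnion.lim xl ∈ U → ∀ᶠ i in atTop, AsympUnion.stage i (x i) ∈ U
  isOpen_univ := by simp
  isOpen_inter := fun U V hU hV =>
    ⟨fun i => (hU.1 i).inter (hV.1 i), hU.2.1.inter hV.2.1,
      fun x xl h hx => (hU.2.2 x xl h hx.1).and (hV.2.2 x xl h hx.2)⟩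
  isOpen_sUnion := fun S hS => by
    refine ⟨fun i => ?_, ?_, ?_⟩
    · have : {x : X i | AsympUnion.stage i x ∈ ⋃₀ S} =
          ⋃ U ∈ S, {x : X i | AsympUnion.stage i x ∈ U} := by ext; simp
      rw [this]
      exact isOpen_biUnion fun U hU => (hS U hU).1 i
    · have : {x : Xl | AsympUnion.lim x ∈ ⋃₀ S} =
          ⋃ U ∈ S, {x : Xl | AsympUnion.lim x ∈ U} := by ext; simp
      rw [this]
      exact isOpen_biUnion fun U hU => (hS U hU).2.1
    · rintro x xl h ⟨U, hU, hx⟩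
      exact ((hS U hU).2.2 x xl h hx).mono fun i hi => ⟨U, hU, hi⟩

end Union

/-! ### Mapping spaces of class `L^p` -/

section LpMap

variable {M Y : Type*} [MeasurableSpace M] [MetricSpace Y]

/-- The space `L^p_ξ(M, Y)` of a.e. classes of measurable maps `u : M → Y` with
`d_{L^p}(u, ξ) < ∞`, where `d_{L^p}(u, v)` is the `L^p`-norm of `x ↦ d(u x, v x)`. -/
def LpMap (p : ℝ≥0∞) (μ : Measure M) (ξ : M → Y) (_hξ : AEStronglyMeasurable ξ μ) : Type _ :=
  {u : M →ₘ[μ] Y // eLpNorm (fun x => dist (u x) (ξ x)) p μ < ∞}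

theorem eLpNorm_dist_triangle {p : ℝ≥0∞} [Fact (1 ≤ p)] {μ : Measure M} {u v w : M → Y}
    (hu : AEStronglyMeasurable u μ) (hv : AEStronglyMeasurable v μ)
    (hw : AEStronglyMeasurable w μ) :
    eLpNorm (fun x => dist (u x) (w x)) p μ ≤
      eLpNorm (fun x => dist (u x) (v x)) p μ + eLpNorm (fun x => dist (v x) (w x)) p μ := by
  refine le_trans (eLpNorm_mono_real (g := (fun x => dist (u x) (v x)) + fun x => dist (v x) (w x))
    fun x => ?_) (eLpNorm_add_le (hu.dist hv) (hv.dist hw) Fact.out)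
  simpa using dist_triangle (u x) (v x) (w x)

theorem LpMap.eLpNorm_dist_ne_top {p : ℝ≥0∞} [Fact (1 ≤ p)] {μ : Measure M} {ξ : M → Y}
    {hξ : AEStronglyMeasurable ξ μ} (u v : LpMap p μ ξ hξ) :
    eLpNorm (fun x => dist (u.1 x) (v.1 x)) p μ ≠ ∞ := by
  refine ne_top_of_le_ne_top ?_
    (eLpNorm_dist_triangle u.1.aestronglyMeasurable hξ v.1.aestronglyMeasurable)
  refine ENNReal.add_ne_top.2 ⟨u.2.ne, ?_⟩
  simpa only [dist_comm] using v.2.ne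

/-- `L^p_ξ(M, Y)` with the distance `d_{L^p}`. -/
noncomputable instance LpMap.instMetricSpace {p : ℝ≥0∞} [Fact (1 ≤ p)] {μ : Measure M} {ξ : M → Y}
    {hξ : AEStronglyMeasurable ξ μ} : MetricSpace (LpMap p μ ξ hξ) where
  dist u v := (eLpNorm (fun x => dist (u.1 x) (v.1 x)) p μ).toReal
  dist_self u := by simp
  dist_comm u v := by simp only [dist_comm]
  dist_triangle u v w := by
    rw [← ENNReal.toReal_add (u.eLpNorm_dist_ne_top v) (v.eLpNorm_dist_ne_top w)]
    exact ENNReal.toReal_mono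
      (ENNReal.add_ne_top.2 ⟨u.eLpNorm_dist_ne_top v, v.eLpNorm_dist_ne_top w⟩)
      (eLpNorm_dist_triangle u.1.aestronglyMeasurable v.1.aestronglyMeasurable
        w.1.aestronglyMeasurable)
  eq_of_dist_eq_zero {u v} h := by
    have hp : p ≠ 0 := (zero_lt_one.trans_le (Fact.out : 1 ≤ p)).ne'
    have h0 : eLpNorm (fun x => dist (u.1 x) (v.1 x)) p μ = 0 :=
      ((ENNReal.toReal_eq_zero_iff _).1 h).resolve_right (u.eLpNorm_dist_ne_top v)
    rw [eLpNorm_eq_zero_iff (u.1.aestronglyMeasurable.dist v.1.aestronglyMeasurable) hp] at h0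
    refine Subtype.ext (AEEqFun.ext ?_)
    filter_upwards [h0] with x hx
    exact dist_eq_zero.1 hx

theorem LpMap.memLp_sub {B : Type*} [NormedAddCommGroup B] {p : ℝ≥0∞} {μ : Measure M} {ξ : M → Y}
    {hξ : AEStronglyMeasurable ξ μ} {α : Y → B} (hα : Isometry α) (u : LpMap p μ ξ hξ) :
    MemLp (fun x => α (u.1 x) - α (ξ x)) p μ := by
  refine ⟨(hα.continuous.comp_aestronglyMeasurable u.1.aestronglyMeasurable).sub
    (hα.continuous.comp_aestronglyMeasurable hξ), ?_⟩
  have : eLpNorm (fun x => α (u.1 x) - α (ξ x)) p μ =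
      eLpNorm (fun x => dist (u.1 x) (ξ x)) p μ := by
    refine eLpNorm_congr_norm_ae (Eventually.of_forall fun x => ?_)
    simp [← dist_eq_norm, hα.dist_eq]
  rw [this]
  exact u.2

/-- The embedding `u ↦ α ∘ u - α ∘ ξ` of `L^p_ξ(M, Y)` into `L^p(M, B)` given by an isometric
embedding `α : Y → B`. -/
noncomputable def LpMap.toLp {B : Type*} [NormedAddCommGroup B] {p : ℝ≥0∞} {μ : Measure M}
    {ξ : M → Y} {hξ : AEStronglyMeasurable ξ μ} {α : Y → B} (hα : Isometry α)
    (u : LpMap p μ ξ hξ) : Lp B p μ :=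
  (LpMap.memLp_sub hα u).toLp _

end LpMap

/-! ### The vector space structure of `L^p_0(M, E)` for a Banach space `E` -/

section Linear

theorem mem_zero_iff {M E : Type*} [MeasurableSpace M] [NormedAddCommGroup E] {p : ℝ≥0∞}
    {μ : Measure M} (u : M →ₘ[μ] E) :
    eLpNorm (fun x => dist (u x) ((0 : M → E) x)) p μ < ∞ ↔ u ∈ Lp E p μ := by
  rw [Lp.mem_Lp_iff_eLpNorm_lt_top,
    eLpNorm_congr_norm_ae (g := u) (Eventually.of_forall fun x => by simp)]

variable {M E : Type*} [MeasurableSpace M] [NormedAddCommGroup E] [NormedSpace ℝ E]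
  {p : ℝ≥0∞} {μ : Measure M} {h0 : AEStronglyMeasurable (0 : M → E) μ}

/-- `L^p_0(M, E)` is the usual Lebesgue space. -/
def LpMap.equivLp : LpMap p μ (0 : M → E) h0 ≃ Lp E p μ :=
  Equiv.subtypeEquivRight mem_zero_iff

noncomputable instance LpMap.instAddCommGroup : AddCommGroup (LpMap p μ (0 : M → E) h0) :=
  LpMap.equivLp.addCommGroup

noncomputable instance LpMap.instModule : Module ℝ (LpMap p μ (0 : M → E) h0) :=
  LpMap.equivLp.module ℝ

theorem LpMap.coe_add (u v : LpMap p μ (0 : M → E) h0) : (u + v).1 = u.1 + v.1 := rfl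

theorem LpMap.coe_smul (a : ℝ) (u : LpMap p μ (0 : M → E) h0) : (a • u).1 = a • u.1 := rfl

/-- The identification with the Lebesgue space as a linear map. -/
noncomputable def LpMap.linearLp : LpMap p μ (0 : M → E) h0 →ₗ[ℝ] Lp E p μ where
  toFun := LpMap.equivLp
  map_add' _ _ := rfl
  map_smul' _ _ := rfl

theorem LpMap.isometry_linearLp [Fact (1 ≤ p)] :
    Isometry (LpMap.linearLp : LpMap p μ (0 : M → E) h0 →ₗ[ℝ] Lp E p μ) := by
  refine Isometry.of_dist_eq fun u v => ?_
  rw [Lp.dist_def]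
  change _ = (eLpNorm (fun x => dist (u.1 x) (v.1 x)) p μ).toReal
  congr 1
  refine eLpNorm_congr_norm_ae (Eventually.of_forall fun x => ?_)
  simp only [Pi.sub_apply, dist_eq_norm, norm_norm]
  rfl

instance LpMap.instIsTopologicalAddGroup [Fact (1 ≤ p)] :
    IsTopologicalAddGroup (LpMap p μ (0 : M → E) h0) :=
  LpMap.isometry_linearLp.isUniformInducing.isInducing.topologicalAddGroup LpMap.linearLp

instance LpMap.instContinuousSMul [Fact (1 ≤ p)] :
    ContinuousSMul ℝ (LpMap p μ (0 : M → E) h0) :=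
  LpMap.isometry_linearLp.isUniformInducing.isInducing.continuousSMul continuous_id
    (fun {a u} => map_smul LpMap.linearLp a u)

end Linear

/-! ### Measure approximations -/

section MeasureApprox

variable {I : Type*} [Preorder I] {M : I → Type*} [∀ i, MeasurableSpace (M i)]
  {N : Type*} [TopologicalSpace N] [MeasurableSpace N]

/-- Measure approximations: measurable maps `φ i` from Borel subsets `dom i ⊆ M i` to `N` such that
the push-forwards of the measures converge vaguely to the measure of `N`. -/
structure MeasureApprox (μ : ∀ i, Measure (M i)) (ν : Measure N) where
  dom : ∀ i, Set (M i)
  measurableSet_dom : ∀ i, MeasurableSet (dom i)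
  toFun : ∀ i, dom i → N
  measurable_toFun : ∀ i, Measurable (toFun i)
  eventually_integrable : ∀ f : C_c(N, ℝ), ∀ᶠ i in atTop,
    Integrable (fun x : dom i => f (toFun i x)) ((μ i).comap Subtype.val)
  tendsto_integral : ∀ f : C_c(N, ℝ),
    Tendsto (fun i => ∫ x : dom i, f (toFun i x) ∂((μ i).comap Subtype.val)) atTop
      (𝓝 (∫ x, f x ∂ν))

variable {μ : ∀ i, Measure (M i)} {ν : Measure N}

/-- The preimage of `C` under `φ i`, as a subset of `M i`. -/
def MeasureApprox.preimage (φ : MeasureApprox μ ν) (i : I) (C : Set N) : Set (M i) :=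
  {x | ∃ hx : x ∈ φ.dom i, φ.toFun i ⟨x, hx⟩ ∈ C}

/-- Equivalence of measure approximations: over every compact set the two maps are eventually
uniformly close where both are defined (for a metric compatible with the topology of `N`), and the
part over a compact set of the domain of one lies in the domain of the other up to a set whose
measure tends to zero. -/
structure MeasureApprox.Equivalent (φ φ' : MeasureApprox μ ν) : Prop where
  close : ∃ d : MetricSpace N,
    d.toPseudoMetricSpace.toUniformSpace.toTopologicalSpace = ‹TopologicalSpace N› ∧
    ∀ C : Set N, IsCompact C → ∀ ε > 0, ∃ i₀, ∀ i ≥ i₀, ∀ (x : M i) (hx : x ∈ φ.dom i)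
      (hx' : x ∈ φ'.dom i), (φ.toFun i ⟨x, hx⟩ ∈ C ∨ φ'.toFun i ⟨x, hx'⟩ ∈ C) →
        d.dist (φ.toFun i ⟨x, hx⟩) (φ'.toFun i ⟨x, hx'⟩) < ε
  dom_left : ∀ C : Set N, IsCompact C →
    Tendsto (fun i => μ i (φ.preimage i C \ φ'.dom i)) atTop (𝓝 0)
  dom_right : ∀ C : Set N, IsCompact C →
    Tendsto (fun i => μ i (φ'.preimage i C \ φ.dom i)) atTop (𝓝 0)

variable {B : Type*} [NormedAddCommGroup B]

open Classical in
/-- `Φ i u` is `u ∘ φ i` on the domain of `φ i` and zero elsewhere. -/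
noncomputable def MeasureApprox.pullback (φ : MeasureApprox μ ν) (i : I) (u : N → B) : M i → B :=
  fun x => if hx : x ∈ φ.dom i then u (φ.toFun i ⟨x, hx⟩) else 0

/-- `L^p`-convergence of `v i ∈ L^p(M i, B)` to `w ∈ L^p(N, B)`: there are compactly supported
continuous maps `w' j` that converge to `w` in `L^p` and satisfy
`lim_j limsup_i d_{L^p}(v i, Φ i (w' j)) = 0`. -/
def MeasureApprox.LpConv (φ : MeasureApprox μ ν) {p : ℝ≥0∞} (v : ∀ i, Lp B p (μ i))
    (w : Lp B p ν) : Prop :=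
  ∃ w' : ℕ → C_c(N, B),
    Tendsto (fun j => eLpNorm (fun x => w' j x - w x) p ν) atTop (𝓝 0) ∧
    Tendsto (fun j => limsup
      (fun i => eLpNorm (fun x => v i x - φ.pullback i (w' j) x) p (μ i)) atTop) atTop (𝓝 0)

variable (B) in
/-- The `L^p`-topology on the disjoint union of the `L^p(M i, B)` and `L^p(N, B)`. -/
@[reducible] noncomputable def lpTopologyBanach (p : ℝ≥0∞) [Fact (1 ≤ p)] (φ : MeasureApprox μ ν) :
    TopologicalSpace (AsympUnion (fun i => Lp B p (μ i)) (Lp B p ν)) :=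
  convTopology φ.LpConv

end MeasureApprox

/-! ### Pointed Gromov-Hausdorff convergence and embeddings of the targets -/

section Targets

variable {I : Type*} [Preorder I] {Y : I → Type*} [∀ i, MetricSpace (Y i)]
  {Z : Type*} [MetricSpace Z]

/-- `f` is an `ε`-approximation from `S` to `T`: it maps `S` to `T`, its distortion on `S` is
smaller than `ε`, and every point of `T` has distance less than `ε` from `f '' S`. -/
structure IsApproximation {A A' : Type*} [MetricSpace A] [MetricSpace A'] (f : A → A') (S : Set A)
    (T : Set A') (ε : ℝ) : Prop where
  mapsTo : MapsTo f S T
  distortion : ∃ δ < ε, ∀ x ∈ S, ∀ y ∈ S, |dist (f x) (f y) - dist x y| ≤ δ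
  dense : ∀ z ∈ T, ∃ x ∈ S, dist (f x) z < ε

/-- `ψ` is a pointed Gromov-Hausdorff approximation from `(Y i, y i)` to `(Z, z)`; only the values
of `ψ i` on the ball `B(y i, r' i)` matter. -/
def IsPointedGHApprox (y : ∀ i, Y i) (z : Z) (ψ : ∀ i, Y i → Z) : Prop :=
  ∃ ε r r' : I → ℝ, (∀ i, 0 < ε i) ∧ Tendsto ε atTop (𝓝 0) ∧
    (∀ i, 0 < r i ∧ r i < r' i) ∧ Tendsto r atTop atTop ∧
    ∀ i, ψ i (y i) = z ∧
      IsApproximation (ψ i) (Metric.ball (y i) (r' i)) (Metric.ball z (r i)) (ε i)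

/-- Isometric embeddings of all `Y i` and of `Z` into one space `B` which realize the
Gromov-Hausdorff convergence given by `ψ`: on every ball of fixed radius about the base points,
the embedded `Y i` is uniformly close to the embedded `Z` along `ψ i`. -/
structure IsRealizingEmbedding {B : Type*} [NormedAddCommGroup B] (y : ∀ i, Y i)
    (ψ : ∀ i, Y i → Z) (α : ∀ i, Y i → B) (αl : Z → B) : Prop where
  isometry : ∀ i, Isometry (α i)
  isometry_lim : Isometry αl
  close : ∀ R : ℝ, ∀ ε > 0, ∀ᶠ i in atTop, ∀ x ∈ Metric.ball (y i) R,
    ‖α i x - αl (ψ i x)‖ < ε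

variable {M : I → Type*} [∀ i, MeasurableSpace (M i)]
  {N : Type*} [TopologicalSpace N] [MeasurableSpace N]
  {μ : ∀ i, Measure (M i)} {ν : Measure N} {B : Type*} [NormedAddCommGroup B]

/-- The base maps are asymptotically compatible:
the `L^p`-norm of `α i ∘ ξ i - αl ∘ ξl ∘ φ i` on the domain of `φ i` tends to zero. -/
def BaseMapsConverge (p : ℝ≥0∞) (φ : MeasureApprox μ ν) (α : ∀ i, Y i → B) (αl : Z → B)
    (ξ : ∀ i, M i → Y i) (ξl : N → Z) : Prop :=
  Tendsto (fun i => eLpNorm (fun x : φ.dom i => α i (ξ i x) - αl (ξl (φ.toFun i x))) p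
    ((μ i).comap Subtype.val)) atTop (𝓝 0)

/-- The embedding of the disjoint union of the spaces `L^p_ξ` into that of the Banach-valued
Lebesgue spaces, which is `u ↦ u - ξ` on each piece. -/
noncomputable def unionEmbedding (p : ℝ≥0∞) {α : ∀ i, Y i → B} {αl : Z → B}
    (hα : ∀ i, Isometry (α i)) (hαl : Isometry αl) {ξ : ∀ i, M i → Y i} {ξl : N → Z}
    (hξ : ∀ i, AEStronglyMeasurable (ξ i) (μ i)) (hξl : AEStronglyMeasurable ξl ν) :
    AsympUnion (fun i => LpMap p (μ i) (ξ i) (hξ i)) (LpMap p ν ξl hξl) →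
      AsympUnion (fun i => Lp B p (μ i)) (Lp B p ν) :=
  AsympUnion.map (fun i => LpMap.toLp (hα i)) (LpMap.toLp hαl)

/-- The `L^p`-topology on the disjoint union of the spaces `L^p_ξ`: the restriction of the
`L^p`-topology of the Banach-valued spaces. -/
@[reducible] noncomputable def lpTopology (p : ℝ≥0∞) [Fact (1 ≤ p)] (φ : MeasureApprox μ ν)
    {α : ∀ i, Y i → B} {αl : Z → B} (hα : ∀ i, Isometry (α i)) (hαl : Isometry αl)
    {ξ : ∀ i, M i → Y i} {ξl : N → Z}
    (hξ : ∀ i, AEStronglyMeasurable (ξ i) (μ i)) (hξl : AEStronglyMeasurable ξl ν) :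
    TopologicalSpace (AsympUnion (fun i => LpMap p (μ i) (ξ i) (hξ i)) (LpMap p ν ξl hξl)) :=
  (lpTopologyBanach B p φ).induced (unionEmbedding p hα hαl hξ hξl)

end Targets

end AsympLp

open AsympLp

/-! The core is a notion of convergence with three properties: every point of the limit space is a
limit, distances between convergent nets converge, and a net at distance tending to zero from a
convergent one has the same limit (`IsMetricConvergence`). Balls of a fixed radius about a
convergent net and its limit are then open in the generated topology, so that topology creates no
new limits (`IsMetricConvergence.convergesIn_iff`), and (A1)-(A4) follow, also on isometrically
embedded pieces whose limit points are reached from within (`isAsymptoticRelation_induced`).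

For Banach targets the model nets are Φ_i w with w continuous and compactly supported. Since ‖w‖^p
is itself a test function, vague convergence gives ‖Φ_i w‖ → ‖w‖; density of the maps w and a
diagonal choice yield the three properties. Equivalent measure approximations move Φ_i w by an
amount tending to zero, which gives item 1.

For metric targets the embedded piece consists of those v for which v + α∘ξ takes values in the
image of α almost everywhere. Two estimates carry this case: a limit of such functions is again of
this kind (`mem_range_toLp_of_lpConv`, closedness), and every point of the limit piece is reached by
points of the stages (`eventually_exists_toLp_close`, `exists_lpConv_toLp`). For item 2, two
embeddings are paired into the product of the Banach spaces. A net converging to s there projects to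
convergent nets for both embeddings, and distances between maps do not depend on the embedding, so
convergence transfers (`lpConv_toLp_of_realizing`). By closedness the subspace topology is
determined by this convergence (`induced_convTopology`).

Linearity is not immediate because the isometries α_i need not be linear. Along an ultrafilter the
bounded nets of vectors form a seminormed space, and taking limits is a surjective isometry onto the
limit target that preserves zero; it is linear by Mazur-Ulam
(`IsRealizingEmbedding.tendsto_linear`). The limit target is finite-dimensional, being proper, so
there are linear maps L_i from it to the stages that approach the identity uniformly on compact
sets. The nets L_i∘Φ_i w are then model nets depending linearly on w, eventually in i
(`lpConv_linear`). -/

namespace AsympLp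

/-! ### Maps between disjoint unions -/

section Union

variable {I : Type*} {X S : I → Type*} {Xl Sl : Type*}

/-- The embeddings of the pieces are injective on the disjoint union. -/
theorem AsympUnion.map_injective {f : ∀ i, S i → X i}
    {g : Sl → Xl} (hf : ∀ i, Function.Injective (f i)) (hg : Function.Injective g) :
    Function.Injective (AsympUnion.map f g) := by
  rintro (⟨i, x⟩ | x) (⟨j, y⟩ | y) hxy
  · simp only [AsympUnion.map, AsympUnion.stage.injEq] at hxy
    obtain ⟨rfl, hxy⟩ := hxy
    rw [hf i (eq_of_heq hxy)]
  · cases hxy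
  · cases hxy
  · simp only [AsympUnion.map, AsympUnion.lim.injEq] at hxy
    rw [hg hxy]

theorem AsympUnion.stage_mem_image_map {f : ∀ i, S i → X i}
    {g : Sl → Xl} {V : Set (AsympUnion S Sl)} {i : I} {x : X i} :
    AsympUnion.stage i x ∈ AsympUnion.map f g '' V ↔
      x ∈ f i '' {s | AsympUnion.stage i s ∈ V} := by
  constructor
  · rintro ⟨a, ha, hax⟩
    cases a with
    | stage j y =>
      cases hax
      exact ⟨y, ha, rfl⟩
    | lim y => cases hax
  · rintro ⟨y, hy, rfl⟩
    exact ⟨.stage i y, hy, rfl⟩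

theorem AsympUnion.lim_mem_image_map {f : ∀ i, S i → X i}
    {g : Sl → Xl} {V : Set (AsympUnion S Sl)} {x : Xl} :
    AsympUnion.lim x ∈ AsympUnion.map f g '' V ↔ x ∈ g '' {s | AsympUnion.lim s ∈ V} := by
  constructor
  · rintro ⟨a, ha, hax⟩
    cases a with
    | stage j y => cases hax
    | lim y =>
      cases hax
      exact ⟨y, ha, rfl⟩
  · rintro ⟨y, hy, rfl⟩
    exact ⟨.lim y, hy, rfl⟩

end Union

/-! ### Convergence structures on nets of metric spaces -/

section Abstract

variable {I : Type*} [Preorder I] {X S : I → Type*} {Xl Sl : Type*}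
  [∀ i, MetricSpace (X i)] [MetricSpace Xl]

/-- A notion of convergence of nets `x i ∈ X i` to points of `Xl` that satisfies the analogues of
(A2) -- (A4). -/
structure IsMetricConvergence (conv : (∀ i, X i) → Xl → Prop) : Prop where
  exists_conv : ∀ xl, ∃ x, conv x xl
  tendsto_dist : ∀ x y xl yl, conv x xl → conv y yl →
    Tendsto (fun i => dist (x i) (y i)) atTop (𝓝 (dist xl yl))
  of_dist : ∀ x y xl, conv x xl → Tendsto (fun i => dist (x i) (y i)) atTop (𝓝 0) → conv y xl

/-- The union of the balls of radius `r` about the members of a net and about its limit. -/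
def convBall (z : ∀ i, X i) (zl : Xl) (r : ℝ) : Set (AsympUnion X Xl)
  | .stage i x => dist x (z i) < r
  | .lim x => dist x zl < r

variable {conv : (∀ i, X i) → Xl → Prop}

/-- A net converging to a point of the limit ball has distances to `z` converging to a number below
`r`, so it ends up in the balls about `z`. These are the open sets that detect convergence. -/
theorem IsMetricConvergence.isOpen_convBall (h : IsMetricConvergence conv) {z : ∀ i, X i} {zl : Xl}
    (hz : conv z zl) (r : ℝ) : IsOpen[convTopology conv] (convBall z zl r) :=
  ⟨fun i => Metric.isOpen_ball (x := z i) (ε := r), Metric.isOpen_ball (x := zl) (ε := r),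
    fun x xl hx hxl => (h.tendsto_dist x z xl zl hx hz).eventually_lt_const hxl⟩

theorem convergesIn_of_conv {x : ∀ i, X i} {xl : Xl} (hx : conv x xl) :
    ConvergesIn (convTopology conv) x xl := by
  let := convTopology conv
  exact tendsto_nhds.2 fun U hU hxl => hU.2.2 x xl hx hxl

/-- Pick one net `z` with `conv z xl`. Topological convergence puts `x` eventually into each
`convBall z xl r`, so the distances to `z` tend to zero and `of_dist` applies. -/
theorem IsMetricConvergence.convergesIn_iff (h : IsMetricConvergence conv) {x : ∀ i, X i}
    {xl : Xl} : ConvergesIn (convTopology conv) x xl ↔ conv x xl := by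
  refine ⟨fun hx => ?_, convergesIn_of_conv⟩
  obtain ⟨z, hz⟩ := h.exists_conv xl
  refine h.of_dist z x xl hz (Metric.tendsto_nhds.2 fun r hr => ?_)
  let := convTopology conv
  have hU := (h.isOpen_convBall hz r).mem_nhds
    (show AsympUnion.lim xl ∈ convBall z xl r from (dist_self xl).trans_lt hr)
  filter_upwards [hx hU] with i hi
  have hi' : dist (x i) (z i) < r := hi
  simpa [dist_comm] using hi'

/-- A subset of one stage contains no limit point, so the condition on convergent nets is vacuous.
-/
theorem isOpen_image_stage {i : I} {V : Set (X i)} (hV : IsOpen V) :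
    IsOpen[convTopology conv] (AsympUnion.stage i '' V) := by
  refine ⟨fun j => ?_, ?_, ?_⟩
  · by_cases hj : j = i
    · subst hj
      convert hV using 1
      ext x
      simp
    · convert isOpen_empty using 1
      ext x
      simp only [mem_image, AsympUnion.stage.injEq, mem_ofPred_eq, mem_empty_iff_false, iff_false]
      rintro ⟨y, -, hij, -⟩
      exact hj hij.symm
  · convert isOpen_empty using 1
    ext x
    simp
  · rintro x xl - ⟨y, -, hy⟩
    cases hy

theorem convergesIn_induced_iff (h : IsMetricConvergence conv) {f : ∀ i, S i → X i} {g : Sl → Xl}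
    {x : ∀ i, S i} {xl : Sl} :
    ConvergesIn ((convTopology conv).induced (AsympUnion.map f g)) x xl ↔
      conv (fun i => f i (x i)) (g xl) := by
  let t := convTopology conv
  rw [← h.convergesIn_iff, ConvergesIn, nhds_induced, tendsto_comap_iff]
  rfl

variable [∀ i, MetricSpace (S i)] [MetricSpace Sl]

/-- The condition `hI` makes each stage closed: a net with one point in every stage eventually
leaves stage `i`. Conditions (A3) and (A4) are inherited because convergence in the induced topology
is `conv` of the embedded net. -/
theorem isAsymptoticRelation_induced (h : IsMetricConvergence conv)
    (hI : ∀ i : I, ∀ᶠ j in atTop, j ≠ i) {f : ∀ i, S i → X i} {g : Sl → Xl}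
    (hf : ∀ i, Isometry (f i)) (hg : Isometry g)
    (hex : ∀ s : Sl, ∃ x : ∀ i, S i, conv (fun i => f i (x i)) (g s)) :
    IsAsymptoticRelation ((convTopology conv).induced (AsympUnion.map f g)) := by
  let t := convTopology conv
  have key : ∀ (x : ∀ i, S i) (xl : Sl), ConvergesIn (t.induced (AsympUnion.map f g)) x xl ↔
      conv (fun i => f i (x i)) (g xl) := fun x xl => convergesIn_induced_iff h
  refine ⟨fun i => ?_, ?_, fun i => ?_, ?_, fun s => ?_, fun x y xl yl hx hy => ?_,
    fun x y xl hx hxy => ?_⟩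
  · refine isClosed_induced_iff.2 ⟨range (AsympUnion.stage i), ⟨?_⟩, ?_⟩
    · refine ⟨fun j => ?_, ?_, fun x xl _ _ => ?_⟩
      · by_cases hj : j = i
        · subst hj
          convert isOpen_empty using 1
          ext x
          simp
        · convert isOpen_univ using 1
          ext x
          simp only [mem_compl_iff, mem_range, AsympUnion.stage.injEq, mem_ofPred_eq, mem_univ,
            iff_true]
          rintro ⟨y, hij, -⟩
          exact hj hij.symm
      · convert isOpen_univ using 1
        ext x
        simp
      · filter_upwards [hI i] with j hj
        rintro ⟨y, hy⟩
        cases hy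
        exact hj rfl
    · ext a
      cases a with
      | stage j x =>
        simp only [mem_preimage, AsympUnion.map, mem_range, AsympUnion.stage.injEq]
        constructor
        · rintro ⟨y, rfl, -⟩
          exact ⟨x, rfl, HEq.rfl⟩
        · rintro ⟨y, rfl, -⟩
          exact ⟨f i x, rfl, HEq.rfl⟩
      | lim x => simp [AsympUnion.map]
  · refine isClosed_induced_iff.2 ⟨range AsympUnion.lim, ⟨?_⟩, ?_⟩
    · refine ⟨fun j => ?_, ?_, fun x xl _ hxl => ?_⟩
      · convert isOpen_univ using 1
        ext x
        simp
      · convert isOpen_empty using 1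
        ext x
        simp
      · simp at hxl
    · ext a
      cases a <;> simp [AsympUnion.map]
  · rw [induced_compose]
    have : AsympUnion.map f g ∘ AsympUnion.stage i = AsympUnion.stage i ∘ f i := rfl
    rw [this, ← induced_compose]
    refine Eq.trans ?_ (hf i).isUniformInducing.isInducing.eq_induced.symm
    congr 1
    refine le_antisymm (fun V hV => ?_) ?_
    · refine ⟨_, isOpen_image_stage (conv := conv) hV, ?_⟩
      ext x
      simp
    · exact continuous_iff_le_induced.1 ⟨fun U hU => hU.1 i⟩
  · rw [induced_compose]
    have : AsympUnion.map f g ∘ AsympUnion.lim = AsympUnion.lim ∘ g := rfl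
    rw [this, ← induced_compose]
    refine Eq.trans ?_ hg.isUniformInducing.isInducing.eq_induced.symm
    congr 1
    refine le_antisymm (fun V hV => ?_) (continuous_iff_le_induced.1 ⟨fun U hU => hU.2.1⟩)
    -- An open set of the limit piece is the trace of a union of `convBall`s, one about a net
    -- converging to each of its points.
    choose z hz using h.exists_conv
    have hV' : ∀ x ∈ V, ∃ r > 0, Metric.ball x r ⊆ V := Metric.isOpen_iff.1 hV
    choose! r hr hrV using hV'
    refine ⟨⋃ x ∈ V, convBall (z x) x (r x),
      isOpen_biUnion fun x _ => h.isOpen_convBall (hz x) (r x), ?_⟩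
    ext y
    simp only [preimage_iUnion, mem_iUnion, mem_preimage, exists_prop]
    exact ⟨fun ⟨x, hx, hy⟩ => hrV x hx hy,
      fun hy => ⟨y, hy, (dist_self y).trans_lt (hr y hy)⟩⟩
  · obtain ⟨x, hx⟩ := hex s
    exact ⟨x, (key x s).2 hx⟩
  · simpa only [(hf _).dist_eq, hg.dist_eq] using
      h.tendsto_dist _ _ _ _ ((key x xl).1 hx) ((key y yl).1 hy)
  · refine (key y xl).2 (h.of_dist _ _ _ ((key x xl).1 hx) ?_)
    simpa only [(hf _).dist_eq] using hxy

/-- A subset of a union of closed pieces is closed in the ambient union if its pieces are closed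
and it contains the limits of all nets that are frequently in it. -/
theorem isClosed_image_map {f : ∀ i, S i → X i} {g : Sl → Xl}
    (hf : ∀ i, IsClosedEmbedding (f i)) (hg : IsClosedEmbedding g) {V : Set (AsympUnion S Sl)}
    (hVs : ∀ i, IsClosed {s : S i | AsympUnion.stage i s ∈ V})
    (hVl : IsClosed {s : Sl | AsympUnion.lim s ∈ V})
    (hcl : ∀ x xl, conv x xl → (∃ᶠ i in atTop, x i ∈ f i '' {s | AsympUnion.stage i s ∈ V}) →
      xl ∈ g '' {s | AsympUnion.lim s ∈ V}) :
    IsClosed[convTopology conv] (AsympUnion.map f g '' V) := by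
  let t := convTopology conv
  refine ⟨⟨fun i => ?_, ?_, fun x xl hx hxl => ?_⟩⟩
  · convert ((hf i).isClosedMap _ (hVs i)).isOpen_compl using 1
    ext x
    simp only [mem_ofPred_eq, mem_compl_iff, AsympUnion.stage_mem_image_map]
  · convert (hg.isClosedMap _ hVl).isOpen_compl using 1
    ext x
    simp only [mem_ofPred_eq, mem_compl_iff, AsympUnion.lim_mem_image_map]
  · simp only [mem_compl_iff, AsympUnion.stage_mem_image_map, AsympUnion.lim_mem_image_map]
      at hxl ⊢
    exact not_frequently.1 fun hfr => hxl (hcl x xl hx hfr)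

theorem isClosed_range_map {f : ∀ i, S i → X i} {g : Sl → Xl}
    (hf : ∀ i, IsClosedEmbedding (f i)) (hg : IsClosedEmbedding g)
    (hcl : ∀ x xl, conv x xl → (∃ᶠ i in atTop, x i ∈ range (f i)) → xl ∈ range g) :
    IsClosed[convTopology conv] (range (AsympUnion.map f g)) := by
  rw [← image_univ]
  refine isClosed_image_map hf hg ?_ ?_ fun x xl hx hfr => ?_
  · simp
  · simp
  · simpa using hcl x xl hx (by simpa using hfr)

/-- On a closed subset all of whose points are limits, the subspace topology is the topology
induced by the restricted notion of convergence. -/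
theorem induced_convTopology (h : IsMetricConvergence conv) {f : ∀ i, S i → X i} {g : Sl → Xl}
    (hf : ∀ i, IsClosedEmbedding (f i)) (hg : IsClosedEmbedding g)
    (hcl : ∀ x xl, conv x xl → (∃ᶠ i in atTop, x i ∈ range (f i)) → xl ∈ range g)
    (hex : ∀ s : Sl, ∃ x : ∀ i, S i, conv (fun i => f i (x i)) (g s)) :
    (convTopology conv).induced (AsympUnion.map f g) =
      convTopology (fun x xl => conv (fun i => f i (x i)) (g xl)) := by
  classical
  have hinj := AsympUnion.map_injective (fun i => (hf i).injective) hg.injective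
  refine le_antisymm (fun V hV => ?_) ?_
  · refine ⟨(AsympUnion.map f g '' Vᶜ)ᶜ, IsClosed.isOpen_compl (self := ?_), ?_⟩
    · refine isClosed_image_map hf hg (fun i => ⟨?_⟩) ⟨?_⟩ fun x xl hx hfr => ?_
      · convert hV.1 i using 1
        ext
        simp
      · convert hV.2.1 using 1
        ext
        simp
      · obtain ⟨s, rfl⟩ := hcl x xl hx (hfr.mono fun i hi => image_subset_range _ _ hi)
        refine ⟨s, fun hs => ?_, rfl⟩
        obtain ⟨z, hz⟩ := hex s
        -- The net is kept where it lies in the image of the complement of `V` and replaced by `z`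
        -- elsewhere. This does not increase the distance to the embedded `z`, so `y` converges to
        -- `s` and is eventually in `V`, against the frequent visits to the complement.
        let y : ∀ i, S i := fun i =>
          if hi : x i ∈ f i '' {s | AsympUnion.stage i s ∈ Vᶜ} then hi.choose else z i
        have hy : conv (fun i => f i (y i)) (g s) := by
          refine h.of_dist _ _ _ hz ?_
          have h0 := h.tendsto_dist _ _ _ _ hz hx
          rw [dist_self] at h0
          refine squeeze_zero (fun _ => dist_nonneg) (fun i => ?_) h0
          by_cases hi : x i ∈ f i '' {s | AsympUnion.stage i s ∈ Vᶜ}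
          · simp only [y, dif_pos hi, hi.choose_spec.2, le_refl]
          · simp only [y, dif_neg hi, dist_self, dist_nonneg]
        obtain ⟨i, hi, hi'⟩ := (hfr.and_eventually (hV.2.2 y s hy hs)).exists
        simp only [y, dif_pos hi] at hi'
        exact hi.choose_spec.1 hi'
    · rw [preimage_compl, preimage_image_eq _ hinj, compl_compl]
  · rintro _ ⟨U, hU, rfl⟩
    exact ⟨fun i => (hU.1 i).preimage (hf i).continuous, hU.2.1.preimage hg.continuous,
      fun x xl hx hxl => hU.2.2 _ _ hx hxl⟩

end Abstract

/-! ### Convergence defined by a dense set of nets -/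

section Approx

variable {I D : Type*} [Preorder I] {X : I → Type*} {Xl : Type*}
  [∀ i, MetricSpace (X i)] [MetricSpace Xl]

/-- Convergence of `x i` to `xl` with respect to a family `P · f` of model nets with limits
`Pl f`. -/
def ApproxConv (P : ∀ i, D → X i) (Pl : D → Xl) (x : ∀ i, X i) (xl : Xl) : Prop :=
  ∀ ε > 0, ∃ f, dist (Pl f) xl < ε ∧ ∀ᶠ i in atTop, dist (x i) (P i f) < ε

variable {P : ∀ i, D → X i} {Pl : D → Xl}

/-- A diagonal choice along a possibly uncountable index set; `ρ` turns the index into a natural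
number that bounds the search. -/
theorem exists_approxConv
    (hd : ∀ f g, Tendsto (fun i => dist (P i f) (P i g)) atTop (𝓝 (dist (Pl f) (Pl g))))
    (hP : DenseRange Pl) {ρ : I → ℕ} (hρ : Tendsto ρ atTop atTop) (xl : Xl) :
    ∃ x : ∀ i, X i, ApproxConv P Pl x xl := by
  classical
  have hpos : ∀ j : ℕ, (0 : ℝ) < 1 / ((j : ℝ) + 1) := fun j => Nat.one_div_pos_of_nat
  choose f hf using fun j : ℕ => hP.exists_dist_lt xl (hpos j)
  -- The bound is what the triangle inequality through `xl` gives in the limit space, strictly, so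
  -- each `Q · j` holds eventually.
  let Q : I → ℕ → Prop := fun i j =>
    ∀ k ≤ j, dist (P i (f j)) (P i (f k)) < 1 / ((j : ℝ) + 1) + 1 / ((k : ℝ) + 1)
  have hQ : ∀ j, ∀ᶠ i in atTop, Q i j := by
    intro j
    have : ∀ k ∈ Finset.range (j + 1), ∀ᶠ i in atTop,
        dist (P i (f j)) (P i (f k)) < 1 / ((j : ℝ) + 1) + 1 / ((k : ℝ) + 1) := fun k _ => by
      refine (hd (f j) (f k)).eventually_lt_const ?_
      have := dist_triangle_left (Pl (f j)) (Pl (f k)) xl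
      linarith [hf j, hf k]
    filter_upwards [(Finset.eventually_all _).2 this] with i hi k hk
    exact hi k (Finset.mem_range.2 (Nat.lt_succ_of_le hk))
  have hQ0 : ∀ i, Q i 0 := fun i k hk => by
    obtain rfl := Nat.le_zero.1 hk
    simp
  -- `Q i 0` always holds, so the value found satisfies `Q` even if it is zero; and `J` eventually
  -- exceeds every `m`.
  let J : I → ℕ := fun i => Nat.findGreatest (Q i) (ρ i)
  refine ⟨fun i => P i (f (J i)), fun ε hε => ?_⟩
  obtain ⟨m, hm⟩ := exists_nat_one_div_lt (half_pos hε)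
  refine ⟨f m, by rw [dist_comm]; linarith [hf m], ?_⟩
  filter_upwards [hQ m, hρ.eventually_ge_atTop m] with i hi hρi
  have hJ : m ≤ J i := Nat.le_findGreatest hρi hi
  have hQJ : Q i (J i) := Nat.findGreatest_spec (P := Q i) (Nat.zero_le _) (hQ0 i)
  have := Nat.one_div_le_one_div (α := ℝ) hJ
  linarith [hQJ m hJ]

theorem isMetricConvergence_approxConv
    (hd : ∀ f g, Tendsto (fun i => dist (P i f) (P i g)) atTop (𝓝 (dist (Pl f) (Pl g))))
    (hP : DenseRange Pl) {ρ : I → ℕ} (hρ : Tendsto ρ atTop atTop) :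
    IsMetricConvergence (ApproxConv P Pl) where
  exists_conv := exists_approxConv hd hP hρ
  tendsto_dist x y xl yl hx hy := by
    refine Metric.tendsto_nhds.2 fun ε hε => ?_
    -- Four errors come from replacing both nets and both limits by models, the fifth from the
    -- convergence of the model distances.
    obtain ⟨f, hf, hfx⟩ := hx (ε / 5) (by positivity)
    obtain ⟨g, hg, hgy⟩ := hy (ε / 5) (by positivity)
    filter_upwards [hfx, hgy, Metric.tendsto_nhds.1 (hd f g) (ε / 5) (by positivity)]
      with i h1 h2 h3
    have h4 := dist_dist_dist_le (x i) (y i) (P i f) (P i g)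
    have h5 := dist_dist_dist_le (Pl f) (Pl g) xl yl
    have h6 := dist_triangle4 (dist (x i) (y i)) (dist (P i f) (P i g)) (dist (Pl f) (Pl g))
      (dist xl yl)
    linarith
  of_dist x y xl hx hxy ε hε := by
    obtain ⟨f, hf, hfx⟩ := hx (ε / 2) (by positivity)
    refine ⟨f, by linarith, ?_⟩
    filter_upwards [hfx, hxy.eventually_lt_const (half_pos hε)] with i h1 h2
    have := dist_triangle_left (y i) (P i f) (x i)
    linarith

end Approx

/-! ### Pull-backs along a measure approximation -/

section Pullback

variable {I : Type*} [Preorder I] {M : I → Type*} [∀ i, MeasurableSpace (M i)]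
  {N : Type*} [TopologicalSpace N] [MeasurableSpace N] {μ : ∀ i, Measure (M i)} {ν : Measure N}
  (φ : MeasureApprox μ ν) {G : Type*} [NormedAddCommGroup G] {p : ℝ≥0∞} {i : I}

namespace MeasureApprox

variable {φ} in
theorem pullback_of_mem {u : N → G} {x : M i} (hx : x ∈ φ.dom i) :
    φ.pullback i u x = u (φ.toFun i ⟨x, hx⟩) := dif_pos hx

variable {φ} in
theorem pullback_of_notMem {u : N → G} {x : M i} (hx : x ∉ φ.dom i) : φ.pullback i u x = 0 :=
  dif_neg hx

theorem pullback_sub (u v : N → G) : φ.pullback i (u - v) = φ.pullback i u - φ.pullback i v := by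
  ext x
  by_cases hx : x ∈ φ.dom i
  · simp [pullback_of_mem hx]
  · simp [pullback_of_notMem hx]

theorem pullback_comp {G' : Type*} [NormedAddCommGroup G'] {T : G → G'} (hT : T 0 = 0) (u : N → G)
    (x : M i) : φ.pullback i (fun y => T (u y)) x = T (φ.pullback i u x) := by
  by_cases hx : x ∈ φ.dom i
  · simp [pullback_of_mem hx]
  · simp [pullback_of_notMem hx, hT]

theorem pullback_eq_extend (u : N → G) :
    φ.pullback i u = Function.extend Subtype.val (u ∘ φ.toFun i) 0 := by
  ext x
  by_cases hx : x ∈ φ.dom i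
  · rw [pullback_of_mem hx]
    exact (Subtype.val_injective.extend_apply (u ∘ φ.toFun i) 0 ⟨x, hx⟩).symm
  · rw [pullback_of_notMem hx, Function.extend_apply']
    · rfl
    · rintro ⟨y, rfl⟩
      exact hx y.2

theorem stronglyMeasurable_pullback {u : N → G} (hu : StronglyMeasurable u) :
    StronglyMeasurable (φ.pullback i u) := by
  rw [pullback_eq_extend]
  exact (MeasurableEmbedding.subtype_coe (φ.measurableSet_dom i)).stronglyMeasurable_extend
    (hu.comp_measurable (φ.measurable_toFun i)) stronglyMeasurable_zero

theorem measurableSet_preimage {C : Set N} (hC : MeasurableSet C) :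
    MeasurableSet (φ.preimage i C) := by
  convert (φ.measurableSet_dom i).subtype_image (φ.measurable_toFun i hC) using 1
  ext x
  simp [preimage]

/-- Norms over the domain of `φ i` are norms over the whole space of the extension by zero. -/
theorem eLpNorm_comap_dom {u : M i → G} (hu : ∀ x ∉ φ.dom i, u x = 0) :
    eLpNorm (fun x : φ.dom i => u x) p ((μ i).comap Subtype.val) = eLpNorm u p (μ i) := by
  have h1 := (MeasurableEmbedding.subtype_coe (φ.measurableSet_dom i)).eLpNorm_map_measure
    (g := u) (p := p) (μ := (μ i).comap Subtype.val)
  rw [map_comap_subtype_coe (φ.measurableSet_dom i)] at h1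
  rw [← eLpNorm_indicator_eq_eLpNorm_restrict (φ.measurableSet_dom i)] at h1
  refine h1.symm.trans (congrArg (eLpNorm · p (μ i)) ?_)
  exact indicator_eq_self.2 fun x hx => by_contra fun hx' => hx (hu x hx')

theorem eLpNorm_pullback (u : N → G) :
    eLpNorm (φ.pullback i u) p (μ i) =
      eLpNorm (fun x => u (φ.toFun i x)) p ((μ i).comap Subtype.val) := by
  rw [← φ.eLpNorm_comap_dom fun x hx => pullback_of_notMem hx]
  congr 1
  ext x
  exact pullback_of_mem x.2

end MeasureApprox

/-- The `r`-th power of the norm of a compactly supported map. -/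
noncomputable def normRpow (f : C_c(N, G)) {r : ℝ} (hr : 0 < r) : C_c(N, ℝ) where
  toFun x := ‖f x‖ ^ r
  continuous_toFun := (f.continuous.norm).rpow_const fun _ => Or.inr hr.le
  hasCompactSupport' := f.hasCompactSupport.comp_left (g := fun y : G => ‖y‖ ^ r)
    (by simp [hr.ne'])

theorem eLpNorm_eq_ofReal_integral {α : Type*} [MeasurableSpace α] {κ : Measure α} {u : α → G}
    (hp0 : p ≠ 0) (hp : p ≠ ∞) (hu : Integrable (fun x => ‖u x‖ ^ p.toReal) κ) :
    eLpNorm u p κ = ENNReal.ofReal (∫ x, ‖u x‖ ^ p.toReal ∂κ) ^ (1 / p.toReal) := by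
  rw [eLpNorm_eq_lintegral_rpow_enorm_toReal hp0 hp,
    ofReal_integral_eq_lintegral_ofReal hu (Eventually.of_forall fun x => by positivity)]
  congr 2
  ext x
  rw [← ofReal_norm, ENNReal.ofReal_rpow_of_nonneg (norm_nonneg _) ENNReal.toReal_nonneg]

theorem MeasureApprox.eventually_memLp_pullback [SecondCountableTopology N] [BorelSpace N]
    (hp0 : p ≠ 0) (hp : p ≠ ∞) (f : C_c(N, G)) :
    ∀ᶠ i in atTop, MemLp (φ.pullback i f) p (μ i) := by
  have hr := ENNReal.toReal_pos hp0 hp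
  filter_upwards [φ.eventually_integrable (normRpow f hr)] with i hi
  refine ⟨(φ.stronglyMeasurable_pullback f.continuous.stronglyMeasurable).aestronglyMeasurable, ?_⟩
  rw [φ.eLpNorm_pullback, eLpNorm_eq_ofReal_integral hp0 hp hi]
  exact ENNReal.rpow_lt_top_of_nonneg (by positivity) ENNReal.ofReal_ne_top

variable [BorelSpace N] [IsFiniteMeasureOnCompacts ν]

/-- Vague convergence is applied to the test function `normRpow f`, and the `p`-th root is
continuous. -/
theorem MeasureApprox.tendsto_eLpNorm_pullback (hp0 : p ≠ 0) (hp : p ≠ ∞) (f : C_c(N, G)) :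
    Tendsto (fun i => eLpNorm (φ.pullback i f) p (μ i)) atTop (𝓝 (eLpNorm f p ν)) := by
  have hr := ENNReal.toReal_pos hp0 hp
  have hf : Integrable (normRpow f hr) ν :=
    (normRpow f hr).continuous.integrable_of_hasCompactSupport (normRpow f hr).hasCompactSupport
  rw [eLpNorm_eq_ofReal_integral hp0 hp hf]
  refine ((ENNReal.continuous_rpow_const.tendsto _).comp
    (ENNReal.tendsto_ofReal (φ.tendsto_integral (normRpow f hr)))).congr' ?_
  filter_upwards [φ.eventually_integrable (normRpow f hr)] with i hi
  rw [φ.eLpNorm_pullback, eLpNorm_eq_ofReal_integral hp0 hp hi]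
  rfl

theorem memLp_compactlySupported (f : C_c(N, G)) : MemLp f p ν :=
  f.continuous.memLp_of_hasCompactSupport f.hasCompactSupport

end Pullback

/-! ### Convergence in `L^p` -/

section LpConv

variable {I : Type*} [Preorder I] {M : I → Type*} [∀ i, MeasurableSpace (M i)]
  {N : Type*} [TopologicalSpace N] [MeasurableSpace N]
  {μ : ∀ i, Measure (M i)} {ν : Measure N}
  (φ : MeasureApprox μ ν) {B : Type*} [NormedAddCommGroup B] {p : ℝ≥0∞}

open Classical in
/-- The class of the pull-back of a compactly supported map, and zero if that is not in `L^p`. -/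
noncomputable def MeasureApprox.pullbackLp (φ : MeasureApprox μ ν) (p : ℝ≥0∞) (i : I)
    (f : C_c(N, B)) : Lp B p (μ i) :=
  if h : MemLp (φ.pullback i f) p (μ i) then h.toLp _ else 0

theorem MeasureApprox.coeFn_pullbackLp {i : I} {w : C_c(N, B)}
    (h : MemLp (φ.pullback i w) p (μ i)) : φ.pullbackLp p i w =ᵐ[μ i] φ.pullback i w := by
  rw [MeasureApprox.pullbackLp, dif_pos h]
  exact h.coeFn_toLp

theorem MeasureApprox.edist_pullbackLp {i : I} {f : C_c(N, B)}
    (h : MemLp (φ.pullback i f) p (μ i)) (v : Lp B p (μ i)) :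
    edist v (φ.pullbackLp p i f) = eLpNorm (fun x => v x - φ.pullback i f x) p (μ i) := by
  rw [MeasureApprox.pullbackLp, dif_pos h, Lp.edist_def]
  refine eLpNorm_congr_ae ?_
  filter_upwards [h.coeFn_toLp] with x hx
  simp [hx]

variable [PolishSpace N] [LocallyCompactSpace N] [BorelSpace N] [IsLocallyFiniteMeasure ν]

/-- The class of a compactly supported map. -/
noncomputable def compactlySupportedToLp (ν : Measure N) [IsLocallyFiniteMeasure ν] (p : ℝ≥0∞)
    (f : C_c(N, B)) : Lp B p ν :=
  (memLp_compactlySupported f).toLp f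

theorem edist_compactlySupportedToLp (f : C_c(N, B)) (w : Lp B p ν) :
    edist (compactlySupportedToLp ν p f) w = eLpNorm (fun x => f x - w x) p ν := by
  rw [compactlySupportedToLp, Lp.edist_def]
  refine eLpNorm_congr_ae ?_
  filter_upwards [(memLp_compactlySupported (p := p) (ν := ν) f).coeFn_toLp] with x hx
  simp [hx]

theorem denseRange_compactlySupportedToLp [NormedSpace ℝ B] [Fact (1 ≤ p)] (hp : p ≠ ∞) :
    DenseRange (compactlySupportedToLp ν p : C_c(N, B) → Lp B p ν) := by
  refine EMetric.dense_iff.2 fun v ε hε => ?_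
  obtain ⟨δ, hδ0, hδ⟩ := exists_between hε
  obtain ⟨g, hg, hgv, hgc, -⟩ := (Lp.memLp v).exists_hasCompactSupport_eLpNorm_sub_le hp hδ0.ne'
  refine ⟨_, ?_, ⟨⟨g, hgc⟩, hg⟩, rfl⟩
  rw [Metric.mem_eball, edist_compactlySupportedToLp]
  refine lt_of_le_of_lt ?_ hδ
  rw [eLpNorm_sub_comm] at hgv
  exact hgv

theorem MeasureApprox.tendsto_dist_pullbackLp [Fact (1 ≤ p)] (hp : p ≠ ∞) (f g : C_c(N, B)) :
    Tendsto (fun i => dist (φ.pullbackLp p i f) (φ.pullbackLp p i g)) atTop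
      (𝓝 (dist (compactlySupportedToLp ν p f) (compactlySupportedToLp ν p g))) := by
  have hp0 : p ≠ 0 := (zero_lt_one.trans_le (Fact.out : 1 ≤ p)).ne'
  have h1 := (ENNReal.tendsto_toReal (memLp_compactlySupported (p := p) (ν := ν) (f - g)).2.ne).comp
    (φ.tendsto_eLpNorm_pullback hp0 hp (f - g))
  have h2 : dist (compactlySupportedToLp ν p f) (compactlySupportedToLp ν p g) =
      (eLpNorm (f - g : C_c(N, B)) p ν).toReal := by
    rw [dist_edist, edist_compactlySupportedToLp]
    congr 1
    refine eLpNorm_congr_ae ?_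
    filter_upwards [(memLp_compactlySupported (p := p) (ν := ν) g).coeFn_toLp] with x hx
    simp [compactlySupportedToLp, hx]
  rw [h2]
  refine h1.congr' ?_
  filter_upwards [φ.eventually_memLp_pullback hp0 hp f, φ.eventually_memLp_pullback hp0 hp g]
    with i hf hg
  rw [dist_edist, φ.edist_pullbackLp hg, Function.comp_apply]
  congr 1
  refine eLpNorm_congr_ae ?_
  filter_upwards [hf.coeFn_toLp] with x hx
  rw [MeasureApprox.pullbackLp, dif_pos hf, hx, CompactlySupportedContinuousMap.coe_sub,
    φ.pullback_sub]
  rfl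

/-- One index `j` with both errors below `ε` provides the model; conversely the models for `ε = 1 /
(j + 1)` form the required sequence. The default value of `pullbackLp` is harmless since pull-backs
are eventually in `L^p`. -/
theorem MeasureApprox.lpConv_iff [Fact (1 ≤ p)] (hp : p ≠ ∞) {v : ∀ i, Lp B p (μ i)}
    {w : Lp B p ν} :
    φ.LpConv v w ↔ ApproxConv (φ.pullbackLp p) (compactlySupportedToLp ν p) v w := by
  have hp0 : p ≠ 0 := (zero_lt_one.trans_le (Fact.out : 1 ≤ p)).ne'
  constructor
  · rintro ⟨w', h1, h2⟩ ε hε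
    have hε' := ENNReal.ofReal_pos.2 hε
    obtain ⟨j, hj1, hj2⟩ := ((h1.eventually_lt_const hε').and (h2.eventually_lt_const hε')).exists
    refine ⟨w' j, ?_, ?_⟩
    · rwa [← edist_lt_ofReal, edist_compactlySupportedToLp]
    · filter_upwards [eventually_lt_of_limsup_lt hj2, φ.eventually_memLp_pullback hp0 hp (w' j)]
        with i hi hm
      rwa [← edist_lt_ofReal, φ.edist_pullbackLp hm]
  · intro h
    choose f hf1 hf2 using fun j : ℕ => h (1 / ((j : ℝ) + 1)) Nat.one_div_pos_of_nat
    have h0 : Tendsto (fun j : ℕ => ENNReal.ofReal (1 / ((j : ℝ) + 1))) atTop (𝓝 0) := by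
      simpa using ENNReal.tendsto_ofReal (tendsto_one_div_add_atTop_nhds_zero_nat (𝕜 := ℝ))
    refine ⟨f, tendsto_of_tendsto_of_tendsto_of_le_of_le tendsto_const_nhds h0
      (fun _ => zero_le) fun j => ?_,
      tendsto_of_tendsto_of_tendsto_of_le_of_le tendsto_const_nhds h0 (fun _ => zero_le)
      fun j => ?_⟩
    · have := hf1 j
      rw [← edist_lt_ofReal, edist_compactlySupportedToLp] at this
      exact this.le
    · refine limsup_le_of_le (h := ?_)
      filter_upwards [hf2 j, φ.eventually_memLp_pullback hp0 hp (f j)] with i hi hm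
      rw [← edist_lt_ofReal, φ.edist_pullbackLp hm] at hi
      exact hi.le

theorem MeasureApprox.isMetricConvergence_lpConv [NormedSpace ℝ B] [Fact (1 ≤ p)] (hp : p ≠ ∞)
    {ρ : I → ℕ} (hρ : Tendsto ρ atTop atTop) :
    IsMetricConvergence (φ.LpConv : (∀ i, Lp B p (μ i)) → Lp B p ν → Prop) := by
  have : (φ.LpConv : (∀ i, Lp B p (μ i)) → Lp B p ν → Prop) =
      ApproxConv (φ.pullbackLp p) (compactlySupportedToLp ν p) := by
    ext v w
    exact φ.lpConv_iff hp
  rw [this]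
  exact isMetricConvergence_approxConv (φ.tendsto_dist_pullbackLp hp)
    (denseRange_compactlySupportedToLp hp) hρ

end LpConv

/-! ### Realizing embeddings -/

section Realizing

variable {I : Type*} [Preorder I] {Y : I → Type*} [∀ i, MetricSpace (Y i)]
  {Z : Type*} [MetricSpace Z] {y : ∀ i, Y i} {z : Z} {ψ : ∀ i, Y i → Z}
  {B : Type*} [NormedAddCommGroup B] {α : ∀ i, Y i → B} {αl : Z → B}

/-- The positive errors tend to zero, hence drop strictly below the error at `i`. -/
theorem IsPointedGHApprox.eventually_ne (h : IsPointedGHApprox y z ψ) (i : I) :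
    ∀ᶠ j in atTop, j ≠ i := by
  obtain ⟨ε, -, -, hε, hε0, -⟩ := h
  filter_upwards [hε0.eventually_lt_const (hε i)] with j hj
  rintro rfl
  exact hj.false

/-- The radii provide the countable scale on which the diagonal choices depend. -/
theorem IsPointedGHApprox.exists_tendsto_nat (h : IsPointedGHApprox y z ψ) :
    ∃ ρ : I → ℕ, Tendsto ρ atTop atTop := by
  obtain ⟨-, r, -, -, -, -, hr, -⟩ := h
  exact ⟨fun i => ⌊r i⌋₊, tendsto_nat_floor_atTop.comp hr⟩

theorem IsRealizingEmbedding.eventually_basepoint (h : IsPointedGHApprox y z ψ)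
    (hα : IsRealizingEmbedding y ψ α αl) : ∀ᶠ i in atTop, ‖α i (y i) - αl z‖ < 1 := by
  obtain ⟨_, _, _, -, -, -, -, h⟩ := h
  filter_upwards [hα.close 1 1 one_pos] with i hi
  have := hi (y i) (Metric.mem_ball_self one_pos)
  rwa [(h i).1] at this

theorem IsRealizingEmbedding.eventually_mem_ball (h : IsPointedGHApprox y z ψ)
    (hα : IsRealizingEmbedding y ψ α αl) (R : ℝ) :
    ∀ᶠ i in atTop, ∀ t : Y i, ‖α i t‖ ≤ R → t ∈ Metric.ball (y i) (R + ‖αl z‖ + 1) := by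
  filter_upwards [hα.eventually_basepoint h] with i hi t ht
  rw [Metric.mem_ball, ← (hα.isometry i).dist_eq, dist_eq_norm]
  have h1 := norm_sub_le (α i t) (α i (y i))
  have h2 := norm_le_insert (αl z) (α i (y i))
  rw [norm_sub_rev] at hi
  linarith

theorem IsRealizingEmbedding.eventually_close (h : IsPointedGHApprox y z ψ)
    (hα : IsRealizingEmbedding y ψ α αl) (R : ℝ) {η : ℝ} (hη : 0 < η) :
    ∀ᶠ i in atTop, ∀ t : Y i, ‖α i t‖ ≤ R → ‖α i t - αl (ψ i t)‖ < η := by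
  filter_upwards [hα.eventually_mem_ball h R, hα.close (R + ‖αl z‖ + 1) η hη] with i hi hi' t ht
  exact hi' t (hi t ht)

theorem IsRealizingEmbedding.eventually_infDist_le (h : IsPointedGHApprox y z ψ)
    (hα : IsRealizingEmbedding y ψ α αl) (R : ℝ) {η : ℝ} (hη : 0 < η) :
    ∀ᶠ i in atTop, ∀ t : Y i, ‖α i t‖ ≤ R → Metric.infDist (α i t) (range αl) ≤ η := by
  filter_upwards [hα.eventually_close h R hη] with i hi t ht
  refine (Metric.infDist_le_dist_of_mem (mem_range_self (ψ i t))).trans ?_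
  rw [dist_eq_norm]
  exact (hi t ht).le

theorem IsRealizingEmbedding.eventually_exists_close (h : IsPointedGHApprox y z ψ)
    (hα : IsRealizingEmbedding y ψ α αl) (R : ℝ) {η : ℝ} (hη : 0 < η) :
    ∀ᶠ i in atTop, ∀ s : Z, ‖αl s‖ ≤ R → ∃ t : Y i, ‖α i t - αl s‖ < η := by
  obtain ⟨ε, r, r', -, hε0, hr, hrt, h⟩ := h
  set R' := R + ‖αl z‖ + 1
  filter_upwards [hε0.eventually_lt_const (half_pos hη), hε0.eventually_lt_const one_pos,
    hrt.eventually_gt_atTop R', hα.close (R' + 2) (η / 2) (half_pos hη)] with i h1 h2 h3 h4 s hs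
  obtain ⟨hy, happ⟩ := h i
  have hsz : dist s z < R' := by
    rw [← hα.isometry_lim.dist_eq, dist_eq_norm]
    linarith [norm_sub_le (αl s) (αl z)]
  obtain ⟨t, ht, hts⟩ := happ.dense s (Metric.mem_ball.2 (hsz.trans h3))
  obtain ⟨δ, hδ, hdist⟩ := happ.distortion
  -- So far `t` lies only in a ball whose radius depends on `i`. Comparing with the base point
  -- bounds its distance to `y i` by `R' + 2`, where the embeddings are uniformly close.
  have h5 := hdist t ht (y i) (Metric.mem_ball_self ((hr i).1.trans (hr i).2))
  rw [hy] at h5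
  have h6 := (abs_le.1 h5).1
  have h7 := dist_triangle (ψ i t) s z
  have h8 := h4 t (Metric.mem_ball.2 (by linarith))
  refine ⟨t, ?_⟩
  have h9 := norm_sub_le_norm_sub_add_norm_sub (α i t) (αl (ψ i t)) (αl s)
  rw [← dist_eq_norm (αl (ψ i t)), hα.isometry_lim.dist_eq] at h9
  linarith

theorem IsRealizingEmbedding.eventually_infDist_le_infDist (h : IsPointedGHApprox y z ψ)
    (hα : IsRealizingEmbedding y ψ α αl) (R : ℝ) {η : ℝ} (hη : 0 < η) :
    ∀ᶠ i in atTop, ∀ b : B, ‖b‖ ≤ R →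
      Metric.infDist b (range (α i)) ≤ Metric.infDist b (range αl) + η := by
  have hne : (range αl).Nonempty := ⟨αl z, mem_range_self z⟩
  filter_upwards [hα.eventually_exists_close h (R + (R + ‖αl z‖ + 1)) (half_pos hη)] with i hi b hb
  -- The slack `η / 2` serves the accuracy; the slack `1` keeps the almost nearest point `s` in a
  -- bounded region.
  obtain ⟨_, ⟨s, rfl⟩, hs⟩ := (Metric.infDist_lt_iff hne).1
    (show Metric.infDist b (range αl) < Metric.infDist b (range αl) + min (η / 2) 1 by
      have : 0 < min (η / 2) 1 := by positivity
      linarith)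
  have h1 : Metric.infDist b (range αl) ≤ R + ‖αl z‖ := by
    refine (Metric.infDist_le_dist_of_mem (mem_range_self z)).trans ?_
    rw [dist_eq_norm]
    exact (norm_sub_le _ _).trans (by linarith)
  have h2 : ‖αl s‖ ≤ R + (R + ‖αl z‖ + 1) := by
    have := norm_le_insert b (αl s)
    rw [dist_eq_norm] at hs
    linarith [min_le_right (η / 2) 1]
  obtain ⟨t, ht⟩ := hi s h2
  refine (Metric.infDist_le_dist_of_mem (mem_range_self t)).trans ?_
  have := dist_triangle b (αl s) (α i t)
  rw [← dist_eq_norm, dist_comm] at ht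
  linarith [min_le_left (η / 2) 1]

/-- Distances between points of the spaces and points in a bounded part of the limit space are
comparable for two realizing embeddings. -/
theorem IsRealizingEmbedding.eventually_norm_sub_le {B' : Type*} [NormedAddCommGroup B']
    {β : ∀ i, Y i → B'} {βl : Z → B'} (h : IsPointedGHApprox y z ψ)
    (hα : IsRealizingEmbedding y ψ α αl) (hβ : IsRealizingEmbedding y ψ β βl) (R : ℝ) {η : ℝ}
    (hη : 0 < η) :
    ∀ᶠ i in atTop, ∀ (t : Y i) (s : Z), ‖αl s‖ ≤ R →
      ‖β i t - βl s‖ ≤ (3 + 2 * R + 2 * ‖αl z‖) * ‖α i t - αl s‖ + η := by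
  filter_upwards [hα.eventually_basepoint h, hβ.eventually_basepoint h,
    hα.eventually_mem_ball h (R + 1), hα.eventually_close h (R + 1) (half_pos hη),
    hβ.close (R + 1 + ‖αl z‖ + 1) (η / 2) (half_pos hη)] with i h1 h2 h3 h4 h5 t s hs
  have hR : 0 ≤ R := (norm_nonneg _).trans hs
  -- If `t` is near `s`, it is bounded and both embeddings can be compared through `ψ i t`, at cost
  -- `η`. If it is far, the path through the base points costs at most `2 + 2 * R + 2 * ‖αl z‖` more
  -- than the distance, which is absorbed multiplicatively as the distance is at least `1`.
  rcases lt_or_ge ‖α i t - αl s‖ 1 with ht | ht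
  · have ht' : ‖α i t‖ ≤ R + 1 := by
      linarith [norm_le_insert (αl s) (α i t), norm_sub_rev (αl s) (α i t)]
    have h6 := norm_sub_le_norm_sub_add_norm_sub (β i t) (βl (ψ i t)) (βl s)
    have h7 := norm_sub_le_norm_sub_add_norm_sub (αl (ψ i t)) (α i t) (αl s)
    have h8 : ‖βl (ψ i t) - βl s‖ = ‖αl (ψ i t) - αl s‖ := by
      rw [← dist_eq_norm, ← dist_eq_norm, hα.isometry_lim.dist_eq, hβ.isometry_lim.dist_eq]
    have h9 := h4 t ht'
    rw [norm_sub_rev] at h9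
    have h10 := h5 t (h3 t ht')
    nlinarith [norm_nonneg (α i t - αl s), norm_nonneg (αl z),
      mul_nonneg hR (norm_nonneg (α i t - αl s)),
      mul_nonneg (norm_nonneg (αl z)) (norm_nonneg (α i t - αl s))]
  · have h6 := dist_triangle4 (β i t) (β i (y i)) (βl z) (βl s)
    rw [(hβ.isometry i).dist_eq, hβ.isometry_lim.dist_eq, ← (hα.isometry i).dist_eq,
      ← hα.isometry_lim.dist_eq] at h6
    simp only [dist_eq_norm] at h6
    have h7 := norm_sub_le_norm_sub_add_norm_sub (α i t) (αl s) (α i (y i))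
    have h8 := norm_sub_le_norm_sub_add_norm_sub (αl s) (αl z) (α i (y i))
    have h9 := norm_sub_le (αl s) (αl z)
    rw [norm_sub_rev] at h1
    rw [norm_sub_rev (αl z)] at h6
    have h10 : 0 ≤ (2 + 2 * R + 2 * ‖αl z‖) * (‖α i t - αl s‖ - 1) := by
      have := norm_nonneg (αl z)
      exact mul_nonneg (by positivity) (by linarith)
    nlinarith

end Realizing

/-! ### Images of spaces of maps in Banach-valued Lebesgue spaces -/

section RangeToLp

variable {M Y B : Type*} [MeasurableSpace M] [MetricSpace Y] [NormedAddCommGroup B]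
  {p : ℝ≥0∞} {μ : Measure M} {ξ : M → Y} {hξ : AEStronglyMeasurable ξ μ} {α : Y → B}
  (hα : Isometry α)

theorem LpMap.coeFn_toLp (u : LpMap p μ ξ hξ) :
    LpMap.toLp hα u =ᵐ[μ] fun x => α (u.1 x) - α (ξ x) :=
  (LpMap.memLp_sub hα u).coeFn_toLp

theorem LpMap.isometry_toLp [Fact (1 ≤ p)] :
    Isometry (LpMap.toLp hα : LpMap p μ ξ hξ → Lp B p μ) := by
  refine Isometry.of_dist_eq fun u v => ?_
  rw [Lp.dist_def]
  change _ = (eLpNorm (fun x => dist (u.1 x) (v.1 x)) p μ).toReal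
  congr 1
  refine eLpNorm_congr_norm_ae ?_
  filter_upwards [coeFn_toLp hα u, coeFn_toLp hα v] with x hx hx'
  simp [hx, hx', ← dist_eq_norm, hα.dist_eq]

/-- Preimages may be chosen pointwise: measurability of the choice follows because `α` is an
embedding, and finiteness of the norm because `α` is isometric. -/
theorem LpMap.mem_range_toLp_iff {v : Lp B p μ} :
    v ∈ range (LpMap.toLp hα : LpMap p μ ξ hξ → Lp B p μ) ↔
      ∀ᵐ x ∂μ, v x + α (ξ x) ∈ range α := by
  classical
  constructor
  · rintro ⟨u, rfl⟩
    filter_upwards [coeFn_toLp hα u] with x hx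
    exact ⟨u.1 x, by simp [hx]⟩
  · intro h
    let u : M → Y := fun x => if hx : v x + α (ξ x) ∈ range α then hx.choose else ξ x
    have hu : (fun x => α (u x)) =ᵐ[μ] fun x => v x + α (ξ x) := by
      filter_upwards [h] with x hx
      simp only [u, dif_pos hx, hx.choose_spec]
    have hum : AEStronglyMeasurable u μ := by
      refine hα.isEmbedding.aestronglyMeasurable_comp_iff.1 (AEStronglyMeasurable.congr ?_ hu.symm)
      exact (Lp.aestronglyMeasurable v).add (hα.continuous.comp_aestronglyMeasurable hξ)
    have hu' : ∀ᵐ x ∂μ, α (AEEqFun.mk u hum x) - α (ξ x) = v x := by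
      filter_upwards [hu, AEEqFun.coeFn_mk u hum] with x hx hx'
      simp [hx', hx]
    refine ⟨⟨AEEqFun.mk u hum, ?_⟩, ?_⟩
    · refine (eLpNorm_congr_norm_ae ?_).trans_lt (Lp.eLpNorm_lt_top v)
      filter_upwards [hu'] with x hx
      rw [← hx, ← dist_eq_norm, hα.dist_eq, Real.norm_of_nonneg dist_nonneg]
    · refine Lp.ext ?_
      filter_upwards [coeFn_toLp hα (⟨AEEqFun.mk u hum, _⟩ : LpMap p μ ξ hξ), hu'] with x hx hx'
      rw [hx, hx']

theorem LpMap.mem_range_toLp_iff_infDist [CompleteSpace Y] [Nonempty Y] {v : Lp B p μ} :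
    v ∈ range (LpMap.toLp hα : LpMap p μ ξ hξ → Lp B p μ) ↔
      ∀ᵐ x ∂μ, Metric.infDist (v x + α (ξ x)) (range α) = 0 := by
  rw [mem_range_toLp_iff]
  refine eventually_congr (Eventually.of_forall fun x => ?_)
  exact hα.isClosedEmbedding.isClosed_range.mem_iff_infDist_zero (range_nonempty α)

/-- The distance to the image of `α` is `1`-Lipschitz and vanishes on it, so the `L^p`-norm of this
distance along `v + α ∘ ξ` is at most the distance of `v` to any member of the range. -/
theorem LpMap.isClosedEmbedding_toLp [CompleteSpace Y] [Nonempty Y] [Fact (1 ≤ p)] :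
    IsClosedEmbedding (LpMap.toLp hα : LpMap p μ ξ hξ → Lp B p μ) := by
  refine ⟨(isometry_toLp hα).isEmbedding, isClosed_of_closure_subset fun v hv => ?_⟩
  have hp0 : p ≠ 0 := (zero_lt_one.trans_le (Fact.out : 1 ≤ p)).ne'
  have hm : AEStronglyMeasurable (fun x => Metric.infDist (v x + α (ξ x)) (range α)) μ :=
    (Metric.continuous_infDist_pt _).comp_aestronglyMeasurable
      ((Lp.aestronglyMeasurable v).add (hα.continuous.comp_aestronglyMeasurable hξ))
  rw [mem_range_toLp_iff_infDist]
  refine (eLpNorm_eq_zero_iff hm hp0).1 (le_antisymm ?_ zero_le)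
  refine ENNReal.le_of_forall_pos_le_add fun ε hε _ => ?_
  obtain ⟨_, ⟨u, rfl⟩, hu⟩ := EMetric.mem_closure_iff.1 hv ε (by exact_mod_cast hε)
  rw [zero_add]
  refine le_trans ?_ hu.le
  rw [Lp.edist_def]
  refine eLpNorm_mono_ae ?_
  filter_upwards [coeFn_toLp hα u] with x hx
  rw [Real.norm_of_nonneg Metric.infDist_nonneg, Pi.sub_apply, hx]
  refine (Metric.infDist_le_dist_of_mem (mem_range_self (u.1 x))).trans_eq ?_
  rw [dist_eq_norm]
  congr 1
  abel

end RangeToLp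

/-! ### Norm estimates and measurable selection -/

section Estimates

/-- The typical `b` is the norm of a pulled-back cut-off function: a uniform pointwise error `η`
over a compact set costs `η` times a convergent quantity. -/
theorem tendsto_zero_of_forall_le {I : Type*} {l : Filter I} {e b : I → ℝ≥0∞} {L : ℝ≥0∞}
    (hb : Tendsto b l (𝓝 L)) (hL : L ≠ ∞)
    (h : ∀ η : NNReal, 0 < η → ∃ a : I → ℝ≥0∞, Tendsto a l (𝓝 0) ∧
      ∀ᶠ i in l, e i ≤ a i + η * b i) : Tendsto e l (𝓝 0) := by
  refine ENNReal.tendsto_nhds_zero.2 fun ε hε => ?_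
  obtain ⟨η, hη, hηL⟩ := ENNReal.exists_nnreal_pos_mul_lt hL hε.ne'
  obtain ⟨a, ha, hea⟩ := h η hη
  have h1 : Tendsto (fun i => a i + η * b i) l (𝓝 (0 + η * L)) :=
    ha.add (ENNReal.Tendsto.const_mul hb (Or.inr ENNReal.coe_ne_top))
  rw [zero_add] at h1
  filter_upwards [hea, h1.eventually_lt_const hηL] with i h2 h3
  exact h2.trans h3.le

variable {M : Type*} [MeasurableSpace M] {κ : Measure M} {p : ℝ≥0∞} [Fact (1 ≤ p)]
  {E F G H : Type*} [NormedAddCommGroup E] [NormedAddCommGroup F] [NormedAddCommGroup G]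
  [NormedAddCommGroup H]

theorem eLpNorm_le_mul_add {u : M → E} {f : M → F} {g : M → G} (a b : NNReal)
    (hf : AEStronglyMeasurable f κ) (hg : AEStronglyMeasurable g κ)
    (h : ∀ᵐ x ∂κ, ‖u x‖ ≤ a * ‖f x‖ + b * ‖g x‖) :
    eLpNorm u p κ ≤ a * eLpNorm f p κ + b * eLpNorm g p κ := by
  have h1 : ∀ (c : NNReal) (k : M → ℝ),
      eLpNorm ((c : ℝ) • k) p κ = c * eLpNorm k p κ := fun c k => by
    rw [eLpNorm_const_smul]
    simp
  rw [← eLpNorm_norm f, ← eLpNorm_norm g, ← h1 a, ← h1 b]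
  exact (eLpNorm_mono_ae_real h).trans
    (eLpNorm_add_le (hf.norm.const_mul _) (hg.norm.const_mul _) Fact.out)

theorem eLpNorm_le_add_add_mul {u : M → E} {f : M → F} {g : M → G} {k : M → H} (c : NNReal)
    (hf : AEStronglyMeasurable f κ) (hg : AEStronglyMeasurable g κ)
    (hk : AEStronglyMeasurable k κ)
    (h : ∀ᵐ x ∂κ, ‖u x‖ ≤ ‖f x‖ + ‖g x‖ + c * ‖k x‖) :
    eLpNorm u p κ ≤ eLpNorm f p κ + eLpNorm g p κ + c * eLpNorm k p κ := by
  have h1 : eLpNorm (fun x => ‖f x‖ + ‖g x‖) p κ ≤ eLpNorm f p κ + eLpNorm g p κ := by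
    rw [← eLpNorm_norm f, ← eLpNorm_norm g]
    exact eLpNorm_add_le hf.norm hg.norm Fact.out
  have h2 := eLpNorm_le_mul_add (p := p) (u := u) (f := fun x => ‖f x‖ + ‖g x‖) 1 c
    (hf.norm.add hg.norm) hk (h.mono fun x hx => hx.trans_eq (by
      rw [Real.norm_of_nonneg (by positivity)]
      simp))
  simp only [ENNReal.coe_one, one_mul] at h2
  exact h2.trans (add_le_add_left h1 _)

/-- Almost nearest points in the image of a separable space can be chosen measurably. -/
theorem exists_aestronglyMeasurable_dist_lt {Y : Type*} [MetricSpace Y]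
    [TopologicalSpace.SeparableSpace Y] [Nonempty Y] {α : Y → E} (hα : Isometry α) {v : M → E}
    (hv : AEStronglyMeasurable v κ) {η : ℝ} (hη : 0 < η) :
    ∃ u : M → Y, AEStronglyMeasurable u κ ∧
      ∀ x, dist (v x) (α (u x)) < Metric.infDist (v x) (range α) + η := by
  classical
  borelize E
  let q := TopologicalSpace.denseSeq Y
  have hex : ∀ b : E, ∃ k, dist b (α (q k)) < Metric.infDist b (range α) + η := by
    intro b
    obtain ⟨_, ⟨t, rfl⟩, ht⟩ := (Metric.infDist_lt_iff (range_nonempty α)).1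
      (show Metric.infDist b (range α) < Metric.infDist b (range α) + η by linarith)
    have hopen : IsOpen {t | dist b (α t) < Metric.infDist b (range α) + η} :=
      isOpen_lt (continuous_const.dist hα.continuous) continuous_const
    obtain ⟨k, hk⟩ := (TopologicalSpace.denseRange_denseSeq Y).exists_mem_open hopen ⟨t, ht⟩
    exact ⟨k, hk⟩
  -- The first admissible member of a dense sequence is taken; admissibility of each member is an
  -- open condition on `b`.
  have hm : Measurable fun b => Nat.find (hex b) := measurable_find hex fun k =>
    (isOpen_lt (continuous_id.dist continuous_const)
      ((Metric.continuous_infDist_pt _).add continuous_const)).measurableSet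
  refine ⟨fun x => q (Nat.find (hex (v x))), ?_, fun x => Nat.find_spec (hex (v x))⟩
  have hs : StronglyMeasurable fun b => q (Nat.find (hex b)) :=
    (StronglyMeasurable.of_discrete (f := q)).comp_measurable hm
  exact hs.aestronglyMeasurable.comp_aemeasurable hv.aemeasurable

end Estimates

/-- A compact set has a compactly supported cut-off function. -/
theorem exists_cutoff {N : Type*} [TopologicalSpace N] [RegularSpace N] [LocallyCompactSpace N]
    {C : Set N} (hC : IsCompact C) :
    ∃ χ : C_c(N, ℝ), (∀ x ∈ C, χ x = 1) ∧ ∀ x, χ x ∈ Icc (0 : ℝ) 1 := by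
  obtain ⟨f, hf1, -, hf2, hf3⟩ :=
    exists_continuous_one_zero_of_isCompact hC isClosed_empty (disjoint_empty C)
  exact ⟨⟨f, hf2⟩, hf1, hf3⟩

/-! ### Local convergence of the base maps -/

section Local

variable {I : Type*} [Preorder I] {Y : I → Type*} {Z : Type*}
  {M : I → Type*} [∀ i, MeasurableSpace (M i)]
  {N : Type*} [TopologicalSpace N] [MeasurableSpace N]
  {μ : ∀ i, Measure (M i)} {ν : Measure N} {B : Type*} [NormedAddCommGroup B]

/-- The difference of the base maps over `C`. -/
noncomputable def baseDefect (φ : MeasureApprox μ ν) (α : ∀ i, Y i → B) (αl : Z → B)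
    (ξ : ∀ i, M i → Y i) (ξl : N → Z) (C : Set N) (i : I) : M i → B :=
  (φ.preimage i C).indicator fun x => α i (ξ i x) - φ.pullback i (αl ∘ ξl) x

/-- Convergence of the base maps in `L^p` over compact sets. -/
def LocalBaseMapsConverge (p : ℝ≥0∞) (φ : MeasureApprox μ ν) (α : ∀ i, Y i → B) (αl : Z → B)
    (ξ : ∀ i, M i → Y i) (ξl : N → Z) : Prop :=
  ∀ C, IsCompact C →
    Tendsto (fun i => eLpNorm (baseDefect φ α αl ξ ξl C i) p (μ i)) atTop (𝓝 0)

variable {p : ℝ≥0∞} {φ : MeasureApprox μ ν} {α : ∀ i, Y i → B} {αl : Z → B}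
  {ξ : ∀ i, M i → Y i} {ξl : N → Z}

theorem baseDefect_apply {C : Set N} {i : I} {x : M i} (hx : x ∈ φ.dom i)
    (hC : φ.toFun i ⟨x, hx⟩ ∈ C) :
    baseDefect φ α αl ξ ξl C i x = α i (ξ i x) - αl (ξl (φ.toFun i ⟨x, hx⟩)) := by
  rw [baseDefect, indicator_of_mem (show x ∈ φ.preimage i C from ⟨hx, hC⟩),
    MeasureApprox.pullback_of_mem hx]
  rfl

theorem BaseMapsConverge.localBaseMapsConverge (h : BaseMapsConverge p φ α αl ξ ξl) :
    LocalBaseMapsConverge p φ α αl ξ ξl := by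
  refine fun C _ => tendsto_of_tendsto_of_tendsto_of_le_of_le tendsto_const_nhds h
    (fun _ => zero_le) fun i => ?_
  have h1 := φ.eLpNorm_comap_dom (p := p)
    (u := (φ.dom i).indicator fun x => α i (ξ i x) - φ.pullback i (αl ∘ ξl) x)
    fun x hx => indicator_of_notMem hx _
  have h2 : (fun x : φ.dom i => α i (ξ i x) - αl (ξl (φ.toFun i x))) = fun x : φ.dom i =>
      (φ.dom i).indicator (fun x => α i (ξ i x) - φ.pullback i (αl ∘ ξl) x) x := by
    ext x
    rw [indicator_of_mem x.2, MeasureApprox.pullback_of_mem x.2]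
    rfl
  rw [h2, h1]
  refine eLpNorm_mono fun x => ?_
  exact norm_indicator_le_of_subset (fun x hx => hx.1) _ _

variable [∀ i, MetricSpace (Y i)] [MetricSpace Z] [PolishSpace N] [BorelSpace N]

theorem aestronglyMeasurable_baseDefect (hα : ∀ i, Continuous (α i)) (hαl : Continuous αl)
    (hξ : ∀ i, AEStronglyMeasurable (ξ i) (μ i)) (hξl : Continuous ξl) {C : Set N}
    (hC : IsCompact C) (i : I) : AEStronglyMeasurable (baseDefect φ α αl ξ ξl C i) (μ i) :=
  (((hα i).comp_aestronglyMeasurable (hξ i)).sub (φ.stronglyMeasurable_pullback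
    (hαl.comp hξl).stronglyMeasurable).aestronglyMeasurable).indicator
      (φ.measurableSet_preimage hC.measurableSet)

variable [Fact (1 ≤ p)] [LocallyCompactSpace N] [IsLocallyFiniteMeasure ν]
  {y : ∀ i, Y i} {z : Z} {ψ : ∀ i, Y i → Z}

/-- Comparing two embeddings with a fixed constant requires `αl ∘ ξl` to be bounded, which holds
over a compact set. Hence the restriction to the local form of the condition. -/
theorem LocalBaseMapsConverge.of_realizing {B' : Type*} [NormedAddCommGroup B']
    {β : ∀ i, Y i → B'} {βl : Z → B'} (h : LocalBaseMapsConverge p φ α αl ξ ξl) (hp : p ≠ ∞)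
    (hψ : IsPointedGHApprox y z ψ) (hα : IsRealizingEmbedding y ψ α αl)
    (hβ : IsRealizingEmbedding y ψ β βl) (hξ : ∀ i, AEStronglyMeasurable (ξ i) (μ i))
    (hξl : Continuous ξl) : LocalBaseMapsConverge p φ β βl ξ ξl := by
  intro C hC
  have hp0 : p ≠ 0 := (zero_lt_one.trans_le (Fact.out : 1 ≤ p)).ne'
  obtain ⟨χ, hχ1, -⟩ := exists_cutoff hC
  obtain ⟨R, hR⟩ := (hC.image (hα.isometry_lim.continuous.comp hξl)).isBounded.exists_norm_le
  refine tendsto_zero_of_forall_le (φ.tendsto_eLpNorm_pullback hp0 hp χ)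
    (memLp_compactlySupported χ).2.ne fun η hη => ?_
  let K : NNReal := (3 + 2 * R + 2 * ‖αl z‖).toNNReal
  refine ⟨fun i => K * eLpNorm (baseDefect φ α αl ξ ξl C i) p (μ i), ?_, ?_⟩
  · simpa using ENNReal.Tendsto.const_mul (h C hC) (Or.inr (ENNReal.coe_ne_top (r := K)))
  · filter_upwards [hα.eventually_norm_sub_le hψ hβ R hη] with i hi
    refine eLpNorm_le_mul_add K η (aestronglyMeasurable_baseDefect
      (fun i => (hα.isometry i).continuous) hα.isometry_lim.continuous hξ hξl hC i)
      (φ.stronglyMeasurable_pullback χ.continuous.stronglyMeasurable).aestronglyMeasurable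
      (Eventually.of_forall fun x => ?_)
    by_cases hx : x ∈ φ.preimage i C
    · obtain ⟨hx, hxC⟩ := hx
      rw [baseDefect_apply hx hxC, baseDefect_apply hx hxC, MeasureApprox.pullback_of_mem hx,
        hχ1 _ hxC, norm_one, mul_one]
      refine (hi _ _ (hR _ (mem_image_of_mem _ hxC))).trans ?_
      exact add_le_add_left (mul_le_mul_of_nonneg_right (Real.le_coe_toNNReal _)
        (norm_nonneg _)) _
    · rw [baseDefect, indicator_of_notMem hx, norm_zero]
      positivity

end Local

/-! ### Closedness and existence of approximating nets -/

section Spaces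

variable {I : Type*} [Preorder I] {Y : I → Type*} {Z : Type*}
  {M : I → Type*} [∀ i, MeasurableSpace (M i)]
  {N : Type*} [TopologicalSpace N] [MeasurableSpace N] [PolishSpace N] [LocallyCompactSpace N]
  [BorelSpace N] {μ : ∀ i, Measure (M i)} {ν : Measure N} [IsLocallyFiniteMeasure ν]
  {B : Type*} [NormedAddCommGroup B] {p : ℝ≥0∞} [Fact (1 ≤ p)]
  {φ : MeasureApprox μ ν} {α : ∀ i, Y i → B} {αl : Z → B}
  {ξ : ∀ i, M i → Y i} {ξl : N → Z} {y : ∀ i, Y i} {z : Z} {ψ : ∀ i, Y i → Z}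

theorem tendsto_defect_add_zero (hp : p ≠ ∞) (hb : LocalBaseMapsConverge p φ α αl ξ ξl)
    {C : Set N} (hC : IsCompact C) (χ : C_c(N, ℝ)) {ε : ℝ≥0∞} (hε : ε ≠ 0) :
    ∃ η : NNReal, 0 < η ∧ ∀ᶠ i in atTop,
      eLpNorm (baseDefect φ α αl ξ ξl C i) p (μ i) + η * eLpNorm (φ.pullback i χ) p (μ i) < ε := by
  have hp0 : p ≠ 0 := (zero_lt_one.trans_le (Fact.out : 1 ≤ p)).ne'
  obtain ⟨η, hη, hηL⟩ := ENNReal.exists_nnreal_pos_mul_lt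
    (memLp_compactlySupported (p := p) (ν := ν) χ).2.ne hε
  refine ⟨η, hη, ?_⟩
  have h1 : Tendsto (fun i => eLpNorm (baseDefect φ α αl ξ ξl C i) p (μ i) +
      η * eLpNorm (φ.pullback i χ) p (μ i)) atTop (𝓝 (0 + η * eLpNorm χ p ν)) :=
    (hb C hC).add (ENNReal.Tendsto.const_mul (φ.tendsto_eLpNorm_pullback hp0 hp χ)
      (Or.inr ENNReal.coe_ne_top))
  rw [zero_add] at h1
  exact h1.eventually_lt_const hηL

variable [∀ i, MetricSpace (Y i)] [MetricSpace Z]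

/-- The limit of a net that is frequently in the images of the spaces `L^p_ξ` is in the image of
the limit space. -/
theorem mem_range_toLp_of_lpConv [CompleteSpace Z] (hp : p ≠ ∞)
    (hψ : IsPointedGHApprox y z ψ) (hα : IsRealizingEmbedding y ψ α αl)
    {hξ : ∀ i, AEStronglyMeasurable (ξ i) (μ i)} (hξl : Continuous ξl)
    (hb : LocalBaseMapsConverge p φ α αl ξ ξl) {v : ∀ i, Lp B p (μ i)} {w : Lp B p ν}
    (h : φ.LpConv v w)
    (hfr : ∃ᶠ i in atTop,
      v i ∈ range (LpMap.toLp (hα.isometry i) : LpMap p (μ i) (ξ i) (hξ i) → Lp B p (μ i))) :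
    w ∈ range (LpMap.toLp hα.isometry_lim :
      LpMap p ν ξl hξl.aestronglyMeasurable → Lp B p ν) := by
  have hp0 : p ≠ 0 := (zero_lt_one.trans_le (Fact.out : 1 ≤ p)).ne'
  have : Nonempty Z := ⟨z⟩
  have hαξ : Continuous fun x => αl (ξl x) := hα.isometry_lim.continuous.comp hξl
  rw [LpMap.mem_range_toLp_iff_infDist]
  suffices H : ∀ C : Set N, IsCompact C →
      ∀ᵐ x ∂ν, x ∈ C → Metric.infDist (w x + αl (ξl x)) (range αl) = 0 by
    filter_upwards [ae_all_iff.2 fun n => H _ (isCompact_compactCovering N n)] with x hx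
    obtain ⟨n, hn⟩ := mem_iUnion.1 ((iUnion_compactCovering N).symm ▸ mem_univ x :
      x ∈ ⋃ n, compactCovering N n)
    exact hx n hn
  intro C hC
  obtain ⟨χ, hχ1, hχ⟩ := exists_cutoff hC
  -- Truncation at `1` is essential: closeness of the embedded spaces is available only on bounded
  -- sets, while the values of `v i` are unbounded.
  let D : B → N → ℝ := fun b x => min (Metric.infDist (b + αl (ξl x)) (range αl)) 1
  have hD0 : ∀ b x, 0 ≤ D b x := fun b x => le_min Metric.infDist_nonneg zero_le_one
  have hDadd : ∀ b b' x, D b x ≤ D b' x + ‖b - b'‖ := by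
    intro b b' x
    have h1 := Metric.infDist_le_infDist_add_dist (s := range αl) (x := b + αl (ξl x))
      (y := b' + αl (ξl x))
    rw [dist_add_right, dist_eq_norm] at h1
    refine min_le_iff.2 ?_
    rcases le_total (Metric.infDist (b' + αl (ξl x)) (range αl)) 1 with h2 | h2
    · exact Or.inl (h1.trans_eq (by rw [show D b' x = _ from min_eq_left h2]))
    · exact Or.inr (by
        rw [show D b' x = 1 from min_eq_right h2]
        linarith [norm_nonneg (b - b')])
  have hDm : AEStronglyMeasurable (fun x => D (w x) x) ν :=
    ((Metric.continuous_infDist_pt _).min continuous_const).comp_aestronglyMeasurable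
      ((Lp.aestronglyMeasurable w).add hαξ.aestronglyMeasurable)
  have key : eLpNorm (fun x => χ x * D (w x) x) p ν = 0 := by
    refine le_antisymm (ENNReal.le_of_forall_pos_le_add fun ε hε _ => ?_) zero_le
    rw [zero_add]
    obtain ⟨f, hf, hfv⟩ := (φ.lpConv_iff hp).1 h (ε / 3) (by positivity)
    have hε3 : ENNReal.ofReal ((ε : ℝ) / 3) = ((ε / 3 : NNReal) : ℝ≥0∞) := by
      rw [← ENNReal.ofReal_coe_nnreal]
      simp
    rw [← edist_lt_ofReal, edist_compactlySupportedToLp, hε3] at hf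
    let g : C_c(N, ℝ) := ⟨⟨fun x => χ x * D (f x) x, χ.continuous.mul
      (((Metric.continuous_infDist_pt _).comp (f.continuous.add hαξ)).min continuous_const)⟩,
      χ.hasCompactSupport.mul_right⟩
    obtain ⟨R, hR⟩ := (χ.hasCompactSupport.isCompact.image (f.continuous.add hαξ)).isBounded
      |>.exists_norm_le
    obtain ⟨η, hη, hηε⟩ := tendsto_defect_add_zero hp hb χ.hasCompactSupport.isCompact χ
      (ε := ((ε / 3 : NNReal) : ℝ≥0∞)) (by
        rw [Ne, ENNReal.coe_eq_zero]
        positivity)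
    have hg : eLpNorm g p ν ≤ ((ε / 3 : NNReal) : ℝ≥0∞) + ((ε / 3 : NNReal) : ℝ≥0∞) := by
      -- The norm of `g` is a limit of norms of pull-backs, so it suffices to bound these
      -- frequently, namely whenever `v i` is in the range.
      refine le_of_tendsto_of_frequently (φ.tendsto_eLpNorm_pullback hp0 hp g) ?_
      refine (hfr.and_eventually (hfv.and ((φ.eventually_memLp_pullback hp0 hp f).and
        (hηε.and (hα.eventually_infDist_le hψ (R + 1) hη))))).mono ?_
      rintro i ⟨⟨u, hu⟩, hvi, hfi, hi, hinf⟩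
      rw [← edist_lt_ofReal, φ.edist_pullbackLp hfi, hε3] at hvi
      refine le_trans (eLpNorm_le_add_add_mul (f := fun x => v i x - φ.pullback i f x)
        (g := baseDefect φ α αl ξ ξl (tsupport χ) i) (k := φ.pullback i χ) η
        ((Lp.aestronglyMeasurable _).sub hfi.1)
        (aestronglyMeasurable_baseDefect (fun i => (hα.isometry i).continuous)
          hα.isometry_lim.continuous hξ hξl χ.hasCompactSupport.isCompact i)
        (φ.stronglyMeasurable_pullback χ.continuous.stronglyMeasurable).aestronglyMeasurable ?_) ?_
      · filter_upwards [LpMap.coeFn_toLp (hα.isometry i) u] with x hx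
        rw [hu] at hx
        by_cases hxd : x ∈ φ.dom i
        · rw [MeasureApprox.pullback_of_mem hxd, MeasureApprox.pullback_of_mem hxd,
            MeasureApprox.pullback_of_mem hxd, hx]
          set t := φ.toFun i ⟨x, hxd⟩ with ht
          change ‖χ t * D (f t) t‖ ≤ _
          rw [Real.norm_of_nonneg (mul_nonneg (hχ t).1 (hD0 _ _)), Real.norm_of_nonneg (hχ t).1]
          by_cases htC : t ∈ tsupport χ
          · rw [baseDefect_apply hxd htC, ← ht]
            set a := ‖α i (u.1 x) - α i (ξ i x) - f t‖
            set b := ‖α i (ξ i x) - αl (ξl t)‖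
            have hab : ‖f t + αl (ξl t) - α i (u.1 x)‖ ≤ a + b := by
              rw [norm_sub_rev]
              refine le_trans (le_of_eq ?_) (norm_add_le _ _)
              congr 1
              abel
            have ha0 : 0 ≤ a := norm_nonneg _
            have hb0 : 0 ≤ b := norm_nonneg _
            have hχt := hχ t
            -- If `a + b < 1`, then `α i (u.1 x)` is bounded by `R + 1` and hence `η`-close to the
            -- range of `αl`. Otherwise the truncated distance is at most `1 ≤ a + b`.
            rcases lt_or_ge (a + b) 1 with h1 | h1
            · have h2 : ‖α i (u.1 x)‖ ≤ R + 1 := by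
                have h3 := norm_le_insert (f t + αl (ξl t)) (α i (u.1 x))
                have h4 : ‖f t + αl (ξl t)‖ ≤ R := hR _ (mem_image_of_mem _ htC)
                exact h3.trans (by linarith [hab])
              have h5 := hinf _ h2
              have h6 := Metric.infDist_le_infDist_add_dist (s := range αl)
                (x := f t + αl (ξl t)) (y := α i (u.1 x))
              rw [dist_eq_norm] at h6
              have h7 : D (f t) t ≤ a + b + η :=
                (min_le_left _ _).trans ((h6.trans (add_le_add h5 hab)).trans_eq (add_comm _ _))
              calc χ t * D (f t) t ≤ χ t * (a + b + η) := mul_le_mul_of_nonneg_left h7 hχt.1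
                _ = χ t * (a + b) + η * χ t := by ring
                _ ≤ 1 * (a + b) + η * χ t := by
                  have := mul_le_mul_of_nonneg_right hχt.2 (add_nonneg ha0 hb0)
                  linarith
                _ = _ := by ring
            · have h8 : χ t * D (f t) t ≤ 1 :=
                mul_le_one₀ hχt.2 (hD0 _ _) (min_le_right _ _)
              have h9 : 0 ≤ (η : ℝ) * χ t := mul_nonneg η.2 hχt.1
              linarith
          · rw [image_eq_zero_of_notMem_tsupport htC]
            simp only [zero_mul, mul_zero, add_zero]
            positivity
        · rw [MeasureApprox.pullback_of_notMem hxd, norm_zero]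
          positivity
      · rw [add_assoc]
        exact add_le_add hvi.le hi.le
    have h1 := eLpNorm_le_mul_add (p := p) (κ := ν) (u := fun x => χ x * D (w x) x) (f := g)
      (g := fun x => f x - w x) 1 1 g.continuous.aestronglyMeasurable
      (f.continuous.aestronglyMeasurable.sub (Lp.aestronglyMeasurable w))
      (Eventually.of_forall fun x => by
        change ‖χ x * D (w x) x‖ ≤ (1 : ℝ) * ‖χ x * D (f x) x‖ + 1 * ‖f x - w x‖
        rw [Real.norm_of_nonneg (mul_nonneg (hχ x).1 (hD0 _ _)),
          Real.norm_of_nonneg (mul_nonneg (hχ x).1 (hD0 _ _)), norm_sub_rev, one_mul]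
        refine (mul_le_mul_of_nonneg_left (hDadd (w x) (f x) x) (hχ x).1).trans ?_
        rw [mul_add]
        exact add_le_add_right (mul_le_mul_of_nonneg_right (hχ x).2 (norm_nonneg _)) _)
    refine h1.trans ?_
    simp only [ENNReal.coe_one, one_mul]
    refine (add_le_add hg hf.le).trans_eq ?_
    rw [← ENNReal.coe_add, ← ENNReal.coe_add]
    congr 1
    rw [← NNReal.coe_inj]
    push_cast
    ring
  replace key := (eLpNorm_eq_zero_iff (χ.continuous.aestronglyMeasurable.mul hDm) hp0).1 key
  filter_upwards [key] with x hx hxC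
  have hx' : χ x * D (w x) x = 0 := hx
  rw [hχ1 x hxC, one_mul] at hx'
  rcases min_choice (Metric.infDist (w x + αl (ξl x)) (range αl)) 1 with h1 | h1
  · exact h1.symm.trans hx'
  · exact absurd (h1.symm.trans hx') one_ne_zero

end Spaces

section Existence

variable {I : Type*} [Preorder I] {Y : I → Type*} [∀ i, MetricSpace (Y i)]
  {Z : Type*} [MetricSpace Z] {M : I → Type*} [∀ i, MeasurableSpace (M i)]
  {N : Type*} [TopologicalSpace N] [MeasurableSpace N] [PolishSpace N] [LocallyCompactSpace N]
  [BorelSpace N] {μ : ∀ i, Measure (M i)} {ν : Measure N} [IsLocallyFiniteMeasure ν]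
  {B : Type*} [NormedAddCommGroup B] {p : ℝ≥0∞}
  {φ : MeasureApprox μ ν} {α : ∀ i, Y i → B} {αl : Z → B}
  {ξ : ∀ i, M i → Y i} {ξl : N → Z} {y : ∀ i, Y i} {z : Z} {ψ : ∀ i, Y i → Z}

/-- An almost everywhere defined map whose embedded difference to the base map is close to an
`L^p`-function gives a point of `L^p_ξ`. -/
theorem LpMap.exists_toLp_eq {M Y : Type*} [MeasurableSpace M] [MetricSpace Y] {μ : Measure M}
    {ξ : M → Y} {hξ : AEStronglyMeasurable ξ μ} {α : Y → B} (hα : Isometry α) {u : M → Y}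
    (hu : AEStronglyMeasurable u μ) {f : M → B} (hf : MemLp f p μ)
    (hfu : eLpNorm (fun x => α (u x) - α (ξ x) - f x) p μ < ∞) :
    ∃ s : LpMap p μ ξ hξ, LpMap.toLp hα s =ᵐ[μ] fun x => α (u x) - α (ξ x) := by
  have hm : AEStronglyMeasurable (fun x => α (u x) - α (ξ x)) μ :=
    (hα.continuous.comp_aestronglyMeasurable hu).sub (hα.continuous.comp_aestronglyMeasurable hξ)
  have h1 : MemLp (fun x => α (u x) - α (ξ x)) p μ := by
    have h2 : MemLp (fun x => α (u x) - α (ξ x) - f x) p μ := ⟨hm.sub hf.1, hfu⟩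
    convert h2.add hf using 1
    ext x
    simp
  obtain ⟨s, hs⟩ := (LpMap.mem_range_toLp_iff (hξ := hξ) hα (v := h1.toLp _)).2 (by
    filter_upwards [h1.coeFn_toLp] with x hx
    rw [hx, sub_add_cancel]
    exact mem_range_self _)
  exact ⟨s, hs ▸ h1.coeFn_toLp⟩

variable [Fact (1 ≤ p)]

/-- Near the pull-back of a compactly supported map there is a map to the embedded spaces, if the
compactly supported map is close to the embedded limit space. -/
theorem eventually_exists_toLp_close [∀ i, ProperSpace (Y i)] (hp : p ≠ ∞)
    (hψ : IsPointedGHApprox y z ψ) (hα : IsRealizingEmbedding y ψ α αl)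
    (hξ : ∀ i, AEStronglyMeasurable (ξ i) (μ i)) (hξl : Continuous ξl)
    (hb : LocalBaseMapsConverge p φ α αl ξ ξl)
    (s : LpMap p ν ξl hξl.aestronglyMeasurable) (f : C_c(N, B)) {ε : ℝ≥0∞}
    (hf : edist (compactlySupportedToLp ν p f) (LpMap.toLp hα.isometry_lim s) < ε) :
    ∀ᶠ i in atTop, ∃ u : LpMap p (μ i) (ξ i) (hξ i),
      edist (LpMap.toLp (hα.isometry i) u) (φ.pullbackLp p i f) < ε + ε := by
  have hp0 : p ≠ 0 := (zero_lt_one.trans_le (Fact.out : 1 ≤ p)).ne'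
  have hε0 : ε ≠ 0 := (zero_le.trans_lt hf).ne'
  have hαξ : Continuous fun x => αl (ξl x) := hα.isometry_lim.continuous.comp hξl
  -- The distance vanishes wherever `f` does, because `αl (ξl x)` is in the range; this gives the
  -- compact support.
  let h : C_c(N, ℝ) := ⟨⟨fun x => Metric.infDist (f x + αl (ξl x)) (range αl),
    (Metric.continuous_infDist_pt _).comp (f.continuous.add hαξ)⟩,
    f.hasCompactSupport.mono' fun x hx => subset_tsupport _ (by
      contrapose! hx
      simp only [Function.mem_support, not_not] at hx
      simp only [Function.mem_support, not_not, hx, zero_add]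
      exact Metric.infDist_zero_of_mem (mem_range_self _))⟩
  have hh : ∀ x, h x = Metric.infDist (f x + αl (ξl x)) (range αl) := fun _ => rfl
  have hhε : eLpNorm h p ν < ε := by
    refine lt_of_le_of_lt ?_ hf
    rw [edist_compactlySupportedToLp]
    refine eLpNorm_mono_ae ?_
    filter_upwards [LpMap.coeFn_toLp hα.isometry_lim s] with x hx
    rw [hh, Real.norm_of_nonneg Metric.infDist_nonneg, hx]
    refine (Metric.infDist_le_dist_of_mem (mem_range_self (s.1 x))).trans_eq ?_
    rw [dist_eq_norm]
    congr 1
    abel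
  have hC := f.hasCompactSupport.isCompact
  obtain ⟨χ, hχ1, hχ⟩ := exists_cutoff hC
  obtain ⟨R, hR⟩ := (hC.image (f.continuous.add hαξ)).isBounded.exists_norm_le
  obtain ⟨η, hη, hηε⟩ := tendsto_defect_add_zero hp hb hC χ hε0
  -- One half is for the choice of almost nearest points, the other for replacing the range of `αl`
  -- by that of `α i`.
  have hη2 : 0 < (η : ℝ) / 2 := by positivity
  filter_upwards [hηε, (φ.tendsto_eLpNorm_pullback hp0 hp h).eventually_lt_const hhε,
    φ.eventually_memLp_pullback hp0 hp f, hα.eventually_infDist_le_infDist hψ R hη2]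
    with i h1 h2 hfi hinf
  have hne : Nonempty (Y i) := ⟨y i⟩
  obtain ⟨q, hqm, hq⟩ := exists_aestronglyMeasurable_dist_lt (hα.isometry i)
    (hfi.1.add ((hα.isometry i).continuous.comp_aestronglyMeasurable (hξ i))) hη2
  classical
  -- Over the support of `f` the value is almost nearest to the translate of `Φ i f` by the base
  -- map; elsewhere `Φ i f` is zero and the base map itself is exact.
  let u : M i → Y i := (φ.preimage i (tsupport f)).piecewise q (ξ i)
  have hu : AEStronglyMeasurable u (μ i) := AEStronglyMeasurable.piecewise
    (φ.measurableSet_preimage hC.measurableSet) hqm.restrict (hξ i).restrict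
  have hest : eLpNorm (fun x => α i (u x) - α i (ξ i x) - φ.pullback i f x) p (μ i) < ε + ε := by
    refine lt_of_le_of_lt (eLpNorm_le_add_add_mul (f := φ.pullback i h)
        (g := baseDefect φ α αl ξ ξl (tsupport f) i) (k := φ.pullback i χ) η
        (φ.stronglyMeasurable_pullback h.continuous.stronglyMeasurable).aestronglyMeasurable
        (aestronglyMeasurable_baseDefect (fun i => (hα.isometry i).continuous)
          hα.isometry_lim.continuous hξ hξl hC i)
        (φ.stronglyMeasurable_pullback χ.continuous.stronglyMeasurable).aestronglyMeasurable
        (Eventually.of_forall fun x => ?_)) (by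
          rw [add_assoc]
          exact ENNReal.add_lt_add h2 h1)
    by_cases hx : x ∈ φ.preimage i (tsupport f)
    · have hux : u x = q x := piecewise_eq_of_mem _ _ _ hx
      obtain ⟨hxd, hxC⟩ := hx
      have h3 := hq x
      rw [Pi.add_apply, MeasureApprox.pullback_of_mem hxd, ← hux] at h3
      rw [baseDefect_apply hxd hxC, MeasureApprox.pullback_of_mem hxd,
        MeasureApprox.pullback_of_mem hxd, MeasureApprox.pullback_of_mem hxd, hχ1 _ hxC, hh]
      set t := φ.toFun i ⟨x, hxd⟩
      have h4 : Metric.infDist (f t + αl (ξl t)) (range (α i)) ≤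
          Metric.infDist (f t + αl (ξl t)) (range αl) + η / 2 :=
        hinf _ (hR _ (mem_image_of_mem _ hxC))
      have h5 := Metric.infDist_le_infDist_add_dist (s := range (α i))
        (x := f t + α i (ξ i x)) (y := f t + αl (ξl t))
      rw [dist_add_left, dist_eq_norm] at h5
      have h6 : ‖α i (u x) - α i (ξ i x) - f t‖ = dist (f t + α i (ξ i x)) (α i (u x)) := by
        rw [dist_comm, dist_eq_norm]
        congr 1
        abel
      rw [h6, Real.norm_of_nonneg Metric.infDist_nonneg, norm_one, mul_one]
      refine (h3.le.trans (add_le_add_left (h5.trans (add_le_add_left h4 _)) _)).trans_eq ?_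
      ring
    · have hux : u x = ξ i x := piecewise_eq_of_notMem _ _ _ hx
      have hf0 : φ.pullback i f x = 0 := by
        by_cases hxd : x ∈ φ.dom i
        · rw [MeasureApprox.pullback_of_mem hxd]
          exact image_eq_zero_of_notMem_tsupport fun hxC => hx ⟨hxd, hxC⟩
        · exact MeasureApprox.pullback_of_notMem hxd
      rw [hux, hf0, sub_self, sub_self, norm_zero]
      positivity
  by_cases hεt : ε = ∞
  · obtain ⟨s, -⟩ := LpMap.exists_toLp_eq (p := p) (hξ := hξ i) (hα.isometry i) (hξ i)
      (MemLp.zero (p := p) (μ := μ i) (ε := B)) (by simp)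
    refine ⟨s, ?_⟩
    rw [hεt, top_add]
    exact (edist_ne_top _ _).lt_top
  obtain ⟨s, hs⟩ := LpMap.exists_toLp_eq (hξ := hξ i) (hα.isometry i) hu hfi
    (hest.trans (ENNReal.add_lt_top.2 ⟨Ne.lt_top hεt, Ne.lt_top hεt⟩))
  refine ⟨s, ?_⟩
  rw [φ.edist_pullbackLp hfi]
  refine lt_of_le_of_lt (le_of_eq (eLpNorm_congr_ae ?_)) hest
  filter_upwards [hs] with x hx
  rw [hx]

/-- Every point of the limit space is the limit of a net in the embedded spaces. -/
theorem exists_lpConv_toLp [NormedSpace ℝ B] [∀ i, ProperSpace (Y i)] (hp : p ≠ ∞)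
    (hψ : IsPointedGHApprox y z ψ) (hα : IsRealizingEmbedding y ψ α αl)
    (hξ : ∀ i, AEStronglyMeasurable (ξ i) (μ i)) (hξl : Continuous ξl)
    (hb : LocalBaseMapsConverge p φ α αl ξ ξl)
    (s : LpMap p ν ξl hξl.aestronglyMeasurable) :
    ∃ u : ∀ i, LpMap p (μ i) (ξ i) (hξ i),
      φ.LpConv (fun i => LpMap.toLp (hα.isometry i) (u i)) (LpMap.toLp hα.isometry_lim s) := by
  obtain ⟨ρ, hρ⟩ := hψ.exists_tendsto_nat
  have hconv := φ.isMetricConvergence_lpConv (B := B) (p := p) hp hρ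
  obtain ⟨v, hv⟩ := hconv.exists_conv (LpMap.toLp hα.isometry_lim s)
  let S : ∀ i, Set (Lp B p (μ i)) := fun i =>
    range (LpMap.toLp (hα.isometry i) : LpMap p (μ i) (ξ i) (hξ i) → Lp B p (μ i))
  have hne : ∀ i, (S i).Nonempty := fun i => by
    obtain ⟨s, -⟩ := LpMap.exists_toLp_eq (p := p) (hξ := hξ i) (hα.isometry i) (hξ i)
      (MemLp.zero (p := p) (μ := μ i) (ε := B)) (by simp)
    exact ⟨_, mem_range_self s⟩
  have hinf : Tendsto (fun i => Metric.infDist (v i) (S i)) atTop (𝓝 0) := by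
    refine Metric.tendsto_nhds.2 fun ε hε => ?_
    obtain ⟨f, hf, hfv⟩ := (φ.lpConv_iff hp).1 hv (ε / 3) (by positivity)
    filter_upwards [hfv, eventually_exists_toLp_close hp hψ hα hξ hξl hb s f
      (edist_lt_ofReal.2 hf)] with i h1 h2
    obtain ⟨u, hu⟩ := h2
    rw [← ENNReal.ofReal_add (by positivity) (by positivity), edist_lt_ofReal] at hu
    rw [Real.dist_0_eq_abs, abs_of_nonneg Metric.infDist_nonneg]
    refine (Metric.infDist_le_dist_of_mem (mem_range_self u)).trans_lt ?_
    have := dist_triangle_right (v i) (LpMap.toLp (hα.isometry i) u) (φ.pullbackLp p i f)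
    linarith
  -- The infimum need not be attained; the slack `1 / (ρ i + 1)` tends to zero along `I`.
  have h1 : ∀ i, ∃ u : LpMap p (μ i) (ξ i) (hξ i), dist (v i) (LpMap.toLp (hα.isometry i) u) <
      Metric.infDist (v i) (S i) + 1 / ((ρ i : ℝ) + 1) := fun i => by
    obtain ⟨_, ⟨u, rfl⟩, hu⟩ := (Metric.infDist_lt_iff (hne i)).1 (show Metric.infDist (v i) (S i) <
      Metric.infDist (v i) (S i) + 1 / ((ρ i : ℝ) + 1) from
        lt_add_of_pos_right _ Nat.one_div_pos_of_nat)
    exact ⟨u, hu⟩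
  choose u hu using h1
  refine ⟨u, hconv.of_dist _ _ _ hv (squeeze_zero (fun _ => dist_nonneg) (fun i => (hu i).le) ?_)⟩
  simpa using hinf.add ((tendsto_one_div_add_atTop_nhds_zero_nat (𝕜 := ℝ)).comp hρ)

end Existence

/-! ### Equivalent measure approximations -/

theorem exists_forall_dist_lt_of_hasCompactSupport {N B : Type*} [t : TopologicalSpace N]
    [NormedAddCommGroup B] (d : MetricSpace N)
    (hd : d.toPseudoMetricSpace.toUniformSpace.toTopologicalSpace = t) {f : N → B}
    (hf : Continuous f) (hfc : HasCompactSupport f) {η : ℝ} (hη : 0 < η) :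
    ∃ δ > 0, ∀ x y, d.dist x y < δ → ‖f x - f y‖ < η := by
  subst hd
  obtain ⟨δ, hδ, h⟩ := Metric.uniformContinuous_iff.1 (hfc.uniformContinuous_of_continuous hf) η hη
  refine ⟨δ, hδ, fun x y hxy => ?_⟩
  rw [← dist_eq_norm]
  exact h hxy

section Equivalence

variable {I : Type*} [Preorder I] {M : I → Type*} [∀ i, MeasurableSpace (M i)]
  {N : Type*} [TopologicalSpace N] [MeasurableSpace N] {μ : ∀ i, Measure (M i)} {ν : Measure N}
  [PolishSpace N] [LocallyCompactSpace N] [BorelSpace N] [IsLocallyFiniteMeasure ν]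
  {B : Type*} [NormedAddCommGroup B] {p : ℝ≥0∞} [Fact (1 ≤ p)]
  {φ φ' : MeasureApprox μ ν}

/-- Where both maps are defined and one of the points lies in the support, uniform continuity gives
an error `η`, dominated by `η` times the sum of the two pulled-back cut-offs. Where only one is
defined, the values are at most `R` on the set `A i`, whose measure tends to zero. -/
theorem MeasureApprox.Equivalent.tendsto_eLpNorm_sub (h : φ.Equivalent φ') (hp : p ≠ ∞)
    (f : C_c(N, B)) :
    Tendsto (fun i => eLpNorm (φ.pullback i f - φ'.pullback i f) p (μ i)) atTop (𝓝 0) := by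
  have hp0 : p ≠ 0 := (zero_lt_one.trans_le (Fact.out : 1 ≤ p)).ne'
  have hr := ENNReal.toReal_pos hp0 hp
  have hC := f.hasCompactSupport.isCompact
  obtain ⟨χ, hχ1, hχ⟩ := exists_cutoff hC
  obtain ⟨R, hR⟩ := (hC.image f.continuous).isBounded.exists_norm_le
  obtain ⟨d, hd, hclose⟩ := h.close
  let A : ∀ i, Set (M i) := fun i =>
    φ.preimage i (tsupport f) \ φ'.dom i ∪ φ'.preimage i (tsupport f) \ φ.dom i
  have hA : ∀ i, MeasurableSet (A i) := fun i =>
    ((φ.measurableSet_preimage hC.measurableSet).diff (φ'.measurableSet_dom i)).union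
      ((φ'.measurableSet_preimage hC.measurableSet).diff (φ.measurableSet_dom i))
  have hA0 : Tendsto (fun i => μ i (A i)) atTop (𝓝 0) := by
    have h1 := (h.dom_left _ hC).add (h.dom_right _ hC)
    rw [add_zero] at h1
    exact tendsto_of_tendsto_of_tendsto_of_le_of_le tendsto_const_nhds h1 (fun _ => zero_le)
      fun i => measure_union_le _ _
  have hA1 : Tendsto (fun i => eLpNorm ((A i).indicator fun _ => R) p (μ i)) atTop (𝓝 0) := by
    have h1 := ENNReal.Tendsto.const_mul (a := ‖R‖ₑ)
      ((ENNReal.continuous_rpow_const (y := 1 / p.toReal)).tendsto _ |>.comp hA0)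
      (Or.inr (by simp))
    rw [ENNReal.zero_rpow_of_pos (by positivity), mul_zero] at h1
    refine h1.congr fun i => ?_
    rw [eLpNorm_indicator_const (hA i) hp0 hp]
    rfl
  have hχm : ∀ (φ : MeasureApprox μ ν) i, AEStronglyMeasurable (φ.pullback i χ) (μ i) :=
    fun φ i => (φ.stronglyMeasurable_pullback χ.continuous.stronglyMeasurable).aestronglyMeasurable
  have hχ0 : ∀ (φ : MeasureApprox μ ν) i x, 0 ≤ φ.pullback i χ x := fun φ i x => by
    by_cases hx : x ∈ φ.dom i
    · rw [MeasureApprox.pullback_of_mem hx]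
      exact (hχ _).1
    · rw [MeasureApprox.pullback_of_notMem hx]
  have hχL := (memLp_compactlySupported (p := p) (ν := ν) χ).2.ne
  refine tendsto_zero_of_forall_le ((φ.tendsto_eLpNorm_pullback hp0 hp χ).add
    (φ'.tendsto_eLpNorm_pullback hp0 hp χ)) (ENNReal.add_ne_top.2 ⟨hχL, hχL⟩) fun η hη =>
      ⟨_, hA1, ?_⟩
  obtain ⟨δ, hδ, hfδ⟩ := exists_forall_dist_lt_of_hasCompactSupport d hd f.continuous
    f.hasCompactSupport (NNReal.coe_pos.2 hη)
  obtain ⟨i₀, hi₀⟩ := hclose _ hC δ hδ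
  filter_upwards [eventually_ge_atTop i₀] with i hi
  have h1 := eLpNorm_le_mul_add (p := p) (κ := μ i) (u := φ.pullback i f - φ'.pullback i f)
    (f := (A i).indicator fun _ => R) (g := φ.pullback i χ + φ'.pullback i χ) 1 η
    (aestronglyMeasurable_const.indicator (hA i)) ((hχm φ i).add (hχm φ' i))
    (Eventually.of_forall fun x => ?_)
  · rw [ENNReal.coe_one, one_mul] at h1
    refine h1.trans ?_
    gcongr
    exact eLpNorm_add_le (hχm φ i) (hχm φ' i) Fact.out
  · have hnn : ‖φ.pullback i χ x + φ'.pullback i χ x‖ = φ.pullback i χ x + φ'.pullback i χ x :=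
      Real.norm_of_nonneg (add_nonneg (hχ0 φ i x) (hχ0 φ' i x))
    have hη0 : 0 ≤ (η : ℝ) := η.2
    rw [Pi.sub_apply, Pi.add_apply, hnn, NNReal.coe_one, one_mul]
    have hrhs : 0 ≤ ‖(A i).indicator (fun _ => R) x‖ +
        η * (φ.pullback i χ x + φ'.pullback i χ x) :=
      add_nonneg (norm_nonneg _) (mul_nonneg hη0 (add_nonneg (hχ0 φ i x) (hχ0 φ' i x)))
    have key : ∀ t, t ∉ tsupport f → f t = 0 := fun t => image_eq_zero_of_notMem_tsupport
    have hin : ∀ b : B, ‖b‖ ≤ R → x ∈ A i → ‖b‖ ≤ ‖(A i).indicator (fun _ => R) x‖ +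
        η * (φ.pullback i χ x + φ'.pullback i χ x) := fun b hb hxA => by
      rw [indicator_of_mem hxA]
      exact (hb.trans (Real.le_norm_self R)).trans (le_add_of_nonneg_right
        (mul_nonneg hη0 (add_nonneg (hχ0 φ i x) (hχ0 φ' i x))))
    by_cases hx : x ∈ φ.dom i <;> by_cases hx' : x ∈ φ'.dom i
    · by_cases ht : φ.toFun i ⟨x, hx⟩ ∈ tsupport f ∨ φ'.toFun i ⟨x, hx'⟩ ∈ tsupport f
      · have h2 := (hfδ _ _ (hi₀ i hi x hx hx' ht)).le
        have h3 : 1 ≤ φ.pullback i χ x + φ'.pullback i χ x := by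
          rcases ht with ht | ht
          · have := hχ0 φ' i x
            rw [MeasureApprox.pullback_of_mem hx, hχ1 _ ht]
            linarith
          · have := hχ0 φ i x
            rw [MeasureApprox.pullback_of_mem hx', hχ1 _ ht]
            linarith
        rw [MeasureApprox.pullback_of_mem hx, MeasureApprox.pullback_of_mem hx']
        refine h2.trans ((le_mul_of_one_le_right hη0 h3).trans ?_)
        exact le_add_of_nonneg_left (norm_nonneg _)
      · rw [not_or] at ht
        rwa [MeasureApprox.pullback_of_mem (u := f) hx, MeasureApprox.pullback_of_mem (u := f) hx',
          key _ ht.1, key _ ht.2, sub_zero, norm_zero]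
    · rw [MeasureApprox.pullback_of_mem (u := f) hx, MeasureApprox.pullback_of_notMem (u := f) hx',
        sub_zero]
      by_cases ht : φ.toFun i ⟨x, hx⟩ ∈ tsupport f
      · exact hin _ (hR _ (mem_image_of_mem _ ht)) (Or.inl ⟨⟨hx, ht⟩, hx'⟩)
      · rwa [key _ ht, norm_zero]
    · rw [MeasureApprox.pullback_of_notMem (u := f) hx, MeasureApprox.pullback_of_mem (u := f) hx',
        zero_sub, norm_neg]
      by_cases ht : φ'.toFun i ⟨x, hx'⟩ ∈ tsupport f
      · exact hin _ (hR _ (mem_image_of_mem _ ht)) (Or.inr ⟨⟨hx', ht⟩, hx⟩)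
      · rwa [key _ ht, norm_zero]
    · rwa [MeasureApprox.pullback_of_notMem (u := f) hx,
        MeasureApprox.pullback_of_notMem (u := f) hx', sub_zero, norm_zero]

theorem MeasureApprox.Equivalent.tendsto_dist_pullbackLp (h : φ.Equivalent φ') (hp : p ≠ ∞)
    (f : C_c(N, B)) :
    Tendsto (fun i => dist (φ.pullbackLp p i f) (φ'.pullbackLp p i f)) atTop (𝓝 0) := by
  have hp0 : p ≠ 0 := (zero_lt_one.trans_le (Fact.out : 1 ≤ p)).ne'
  have h1 := (ENNReal.tendsto_toReal ENNReal.zero_ne_top).comp (h.tendsto_eLpNorm_sub hp f)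
  refine h1.congr' ?_
  filter_upwards [φ.eventually_memLp_pullback hp0 hp f, φ'.eventually_memLp_pullback hp0 hp f]
    with i hi hi'
  rw [dist_edist, φ'.edist_pullbackLp hi', Function.comp_apply]
  congr 1
  refine eLpNorm_congr_ae ?_
  filter_upwards [hi.coeFn_toLp] with x hx
  rw [MeasureApprox.pullbackLp, dif_pos hi, hx]
  rfl

theorem MeasureApprox.Equivalent.lpConv_iff (h : φ.Equivalent φ') (hp : p ≠ ∞)
    {v : ∀ i, Lp B p (μ i)} {w : Lp B p ν} : φ.LpConv v w ↔ φ'.LpConv v w := by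
  rw [φ.lpConv_iff hp, φ'.lpConv_iff hp]
  constructor <;> intro hv ε hε
  all_goals
    obtain ⟨f, hf, hfv⟩ := hv (ε / 2) (half_pos hε)
    refine ⟨f, hf.trans (half_lt_self hε), ?_⟩
    filter_upwards [hfv, (h.tendsto_dist_pullbackLp hp f).eventually_lt_const (half_pos hε)]
      with i h1 h2
  · linarith [dist_triangle (v i) (φ.pullbackLp p i f) (φ'.pullbackLp p i f)]
  · linarith [dist_triangle_right (v i) (φ.pullbackLp p i f) (φ'.pullbackLp p i f)]

theorem MeasureApprox.Equivalent.lpTopologyBanach_eq (h : φ.Equivalent φ') (hp : p ≠ ∞) :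
    lpTopologyBanach B p φ' = lpTopologyBanach B p φ := by
  have : (φ'.LpConv : (∀ i, Lp B p (μ i)) → Lp B p ν → Prop) = φ.LpConv := by
    ext v w
    exact (h.lpConv_iff hp).symm
  rw [lpTopologyBanach, lpTopologyBanach, this]

end Equivalence

/-! ### Independence of the embedding -/

section Embedding

variable {I : Type*} [Preorder I] {M : I → Type*} [∀ i, MeasurableSpace (M i)]
  {N : Type*} [TopologicalSpace N] [MeasurableSpace N] {μ : ∀ i, Measure (M i)} {ν : Measure N}
  {φ : MeasureApprox μ ν} {B B' : Type*} [NormedAddCommGroup B] [NormedAddCommGroup B'] {p : ℝ≥0∞}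

/-- Convergence in `L^p` is preserved by contractions of the targets. -/
theorem MeasureApprox.LpConv.comp_contraction {T : B → B'} (hT : LipschitzWith 1 T) (hT0 : T 0 = 0)
    {v : ∀ i, Lp B p (μ i)} {w : Lp B p ν} {v' : ∀ i, Lp B' p (μ i)} {w' : Lp B' p ν}
    (hv : ∀ i, v' i =ᵐ[μ i] fun x => T (v i x)) (hw : w' =ᵐ[ν] fun x => T (w x))
    (h : φ.LpConv v w) : φ.LpConv v' w' := by
  have hT' : ∀ a b, ‖T a - T b‖ ≤ ‖a - b‖ := fun a b => by simpa using hT.norm_sub_le a b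
  obtain ⟨f, hf, hfv⟩ := h
  let g : ℕ → C_c(N, B') := fun j => ⟨⟨fun x => T (f j x), hT.continuous.comp (f j).continuous⟩,
    (f j).hasCompactSupport.comp_left hT0⟩
  refine ⟨g, tendsto_of_tendsto_of_tendsto_of_le_of_le tendsto_const_nhds hf (fun _ => zero_le)
    fun j => ?_, tendsto_of_tendsto_of_tendsto_of_le_of_le tendsto_const_nhds hfv
      (fun _ => zero_le) fun j => limsup_le_limsup (Eventually.of_forall fun i => ?_)⟩
  · refine eLpNorm_mono_ae ?_
    filter_upwards [hw] with x hx
    rw [hx]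
    exact hT' _ _
  · refine eLpNorm_mono_ae ?_
    filter_upwards [hv i] with x hx
    rw [hx, show φ.pullback i (g j) x = T (φ.pullback i (f j) x) from φ.pullback_comp hT0 (f j) x]
    exact hT' _ _

variable {Y : I → Type*} [∀ i, MetricSpace (Y i)] {Z : Type*} [MetricSpace Z]
  {α : ∀ i, Y i → B} {αl : Z → B} {β : ∀ i, Y i → B'} {βl : Z → B'}
  {ξ : ∀ i, M i → Y i} {ξl : N → Z} {y : ∀ i, Y i} {z : Z} {ψ : ∀ i, Y i → Z}

theorem Isometry.prodMk {A : Type*} [MetricSpace A] {f : A → B} {g : A → B'} (hf : Isometry f)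
    (hg : Isometry g) : Isometry fun a => (f a, g a) :=
  Isometry.of_dist_eq fun a b => by
    rw [Prod.dist_eq, hf.dist_eq, hg.dist_eq, max_self]

/-- The maximum norm makes the pair isometric, so any two realizing embeddings are projections of a
third. -/
theorem IsRealizingEmbedding.prodMk (hα : IsRealizingEmbedding y ψ α αl)
    (hβ : IsRealizingEmbedding y ψ β βl) :
    IsRealizingEmbedding y ψ (fun i t => (α i t, β i t)) (fun s => (αl s, βl s)) where
  isometry i := Isometry.prodMk (hα.isometry i) (hβ.isometry i)
  isometry_lim := Isometry.prodMk hα.isometry_lim hβ.isometry_lim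
  close R ε hε := by
    filter_upwards [hα.close R ε hε, hβ.close R ε hε] with i h1 h2 t ht
    exact max_lt (h1 t ht) (h2 t ht)

variable [PolishSpace N] [LocallyCompactSpace N] [BorelSpace N] [IsLocallyFiniteMeasure ν]
  [Fact (1 ≤ p)] [∀ i, ProperSpace (Y i)]

theorem isClosed_range_unionEmbedding [ProperSpace Z] (hp : p ≠ ∞) (hψ : IsPointedGHApprox y z ψ)
    (hα : IsRealizingEmbedding y ψ α αl)
    (hξ : ∀ i, AEStronglyMeasurable (ξ i) (μ i)) (hξl : Continuous ξl)
    (hb : LocalBaseMapsConverge p φ α αl ξ ξl) :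
    IsClosed[lpTopologyBanach B p φ] (range (unionEmbedding p hα.isometry hα.isometry_lim hξ
      (hξl.aestronglyMeasurable (μ := ν)))) := by
  have : ∀ i, Nonempty (Y i) := fun i => ⟨y i⟩
  have : Nonempty Z := ⟨z⟩
  exact isClosed_range_map (fun i => LpMap.isClosedEmbedding_toLp (hα.isometry i))
    (LpMap.isClosedEmbedding_toLp hα.isometry_lim)
    (fun v w hvw hfr => mem_range_toLp_of_lpConv hp hψ hα hξl hb hvw hfr)

variable [NormedSpace ℝ B] [NormedSpace ℝ B']

/-- A net `u'` converging to `s` for the paired embedding converges for `α` and for `β`, as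
projections are contractions. For `α` this forces the distance of `u'` and `u` to tend to zero; that
distance is independent of the embedding, so `u` converges for `β`. -/
theorem lpConv_toLp_of_realizing (hp : p ≠ ∞) (hψ : IsPointedGHApprox y z ψ)
    (hα : IsRealizingEmbedding y ψ α αl) (hβ : IsRealizingEmbedding y ψ β βl)
    (hξ : ∀ i, AEStronglyMeasurable (ξ i) (μ i)) (hξl : Continuous ξl)
    (hb : LocalBaseMapsConverge p φ α αl ξ ξl) {u : ∀ i, LpMap p (μ i) (ξ i) (hξ i)}
    {s : LpMap p ν ξl hξl.aestronglyMeasurable}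
    (h : φ.LpConv (fun i => LpMap.toLp (hα.isometry i) (u i)) (LpMap.toLp hα.isometry_lim s)) :
    φ.LpConv (fun i => LpMap.toLp (hβ.isometry i) (u i)) (LpMap.toLp hβ.isometry_lim s) := by
  obtain ⟨ρ, hρ⟩ := hψ.exists_tendsto_nat
  have hγ := hα.prodMk hβ
  obtain ⟨u', hu'⟩ := exists_lpConv_toLp hp hψ hγ hξ hξl (hb.of_realizing hp hψ hα hγ hξ hξl) s
  have h1 : φ.LpConv (fun i => LpMap.toLp (hα.isometry i) (u' i))
      (LpMap.toLp hα.isometry_lim s) := by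
    refine hu'.comp_contraction LipschitzWith.prod_fst rfl (fun i => ?_) ?_
    · filter_upwards [LpMap.coeFn_toLp (hα.isometry i) (u' i),
        LpMap.coeFn_toLp (hγ.isometry i) (u' i)] with x hx hx'
      rw [hx, hx', Prod.fst_sub]
    · filter_upwards [LpMap.coeFn_toLp hα.isometry_lim s,
        LpMap.coeFn_toLp hγ.isometry_lim s] with x hx hx'
      rw [hx, hx', Prod.fst_sub]
  have h2 : φ.LpConv (fun i => LpMap.toLp (hβ.isometry i) (u' i))
      (LpMap.toLp hβ.isometry_lim s) := by
    refine hu'.comp_contraction LipschitzWith.prod_snd rfl (fun i => ?_) ?_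
    · filter_upwards [LpMap.coeFn_toLp (hβ.isometry i) (u' i),
        LpMap.coeFn_toLp (hγ.isometry i) (u' i)] with x hx hx'
      rw [hx, hx', Prod.snd_sub]
    · filter_upwards [LpMap.coeFn_toLp hβ.isometry_lim s,
        LpMap.coeFn_toLp hγ.isometry_lim s] with x hx hx'
      rw [hx, hx', Prod.snd_sub]
  have h3 := (φ.isMetricConvergence_lpConv hp hρ).tendsto_dist _ _ _ _ h1 h
  refine (φ.isMetricConvergence_lpConv hp hρ).of_dist _ _ _ h2 ?_
  simpa only [(LpMap.isometry_toLp _).dist_eq, dist_self] using h3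

/-- The `L^p`-topology is the topology induced by the convergence of embedded maps. -/
theorem lpTopology_eq_convTopology [ProperSpace Z] (hp : p ≠ ∞) (hψ : IsPointedGHApprox y z ψ)
    (hα : IsRealizingEmbedding y ψ α αl)
    (hξ : ∀ i, AEStronglyMeasurable (ξ i) (μ i)) (hξl : Continuous ξl)
    (hb : LocalBaseMapsConverge p φ α αl ξ ξl) :
    lpTopology p φ hα.isometry hα.isometry_lim hξ hξl.aestronglyMeasurable =
      convTopology (fun (u : ∀ i, LpMap p (μ i) (ξ i) (hξ i))
        (s : LpMap p ν ξl hξl.aestronglyMeasurable) =>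
          φ.LpConv (fun i => LpMap.toLp (hα.isometry i) (u i))
            (LpMap.toLp hα.isometry_lim s)) := by
  obtain ⟨ρ, hρ⟩ := hψ.exists_tendsto_nat
  have : ∀ i, Nonempty (Y i) := fun i => ⟨y i⟩
  have : Nonempty Z := ⟨z⟩
  exact induced_convTopology (φ.isMetricConvergence_lpConv hp hρ)
    (fun i => LpMap.isClosedEmbedding_toLp (hα.isometry i))
    (LpMap.isClosedEmbedding_toLp hα.isometry_lim)
    (fun v w hvw hfr => mem_range_toLp_of_lpConv hp hψ hα hξl hb hvw hfr)
    (exists_lpConv_toLp hp hψ hα hξ hξl hb)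

theorem lpTopology_eq_of_realizing [ProperSpace Z] (hp : p ≠ ∞) (hψ : IsPointedGHApprox y z ψ)
    (hα : IsRealizingEmbedding y ψ α αl) (hβ : IsRealizingEmbedding y ψ β βl)
    (hξ : ∀ i, AEStronglyMeasurable (ξ i) (μ i)) (hξl : Continuous ξl)
    (hb : LocalBaseMapsConverge p φ α αl ξ ξl) :
    lpTopology p φ hβ.isometry hβ.isometry_lim hξ hξl.aestronglyMeasurable =
      lpTopology p φ hα.isometry hα.isometry_lim hξ (hξl.aestronglyMeasurable (μ := ν)) := by
  have hb' := hb.of_realizing hp hψ hα hβ hξ hξl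
  rw [lpTopology_eq_convTopology hp hψ hα hξ hξl hb, lpTopology_eq_convTopology hp hψ hβ hξ hξl hb']
  congr 1
  ext u s
  exact ⟨lpConv_toLp_of_realizing hp hψ hβ hα hξ hξl hb',
    lpConv_toLp_of_realizing hp hψ hα hβ hξ hξl hb⟩

theorem isAsymptoticRelation_lpTopology (hp : p ≠ ∞) (hψ : IsPointedGHApprox y z ψ)
    (hα : IsRealizingEmbedding y ψ α αl)
    (hξ : ∀ i, AEStronglyMeasurable (ξ i) (μ i)) (hξl : Continuous ξl)
    (hb : LocalBaseMapsConverge p φ α αl ξ ξl) :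
    IsAsymptoticRelation (lpTopology p φ hα.isometry hα.isometry_lim hξ
      (hξl.aestronglyMeasurable (μ := ν))) := by
  obtain ⟨ρ, hρ⟩ := hψ.exists_tendsto_nat
  exact isAsymptoticRelation_induced (φ.isMetricConvergence_lpConv hp hρ) hψ.eventually_ne
    (fun i => LpMap.isometry_toLp (hα.isometry i)) (LpMap.isometry_toLp hα.isometry_lim)
    (exists_lpConv_toLp hp hψ hα hξ hξl hb)

end Embedding

/-! ### Ultraproducts of normed spaces -/

section Ultraproduct

variable {I : Type*} (U : Ultrafilter I) (E : I → Type*) [∀ i, NormedAddCommGroup (E i)]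
  [∀ i, NormedSpace ℝ (E i)]

/-- The nets that are bounded along an ultrafilter. -/
def boundedNets : Submodule ℝ (∀ i, E i) where
  carrier := {x | ∃ R, ∀ᶠ i in (U : Filter I), ‖x i‖ ≤ R}
  add_mem' := by
    rintro x x' ⟨R, hR⟩ ⟨R', hR'⟩
    refine ⟨R + R', ?_⟩
    filter_upwards [hR, hR'] with i h h'
    exact (norm_add_le _ _).trans (add_le_add h h')
  zero_mem' := ⟨0, by simp⟩
  smul_mem' := by
    rintro a x ⟨R, hR⟩
    refine ⟨|a| * R, ?_⟩
    filter_upwards [hR] with i h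
    rw [Pi.smul_apply, norm_smul, Real.norm_eq_abs]
    gcongr

/-- The space of nets that are bounded along an ultrafilter, with the limit of the norms as its
seminorm. -/
def BoundedNet : Type _ := boundedNets U E

instance : AddCommGroup (BoundedNet U E) := inferInstanceAs (AddCommGroup (boundedNets U E))

instance : Module ℝ (BoundedNet U E) := inferInstanceAs (Module ℝ (boundedNets U E))

variable {U E}

theorem BoundedNet.exists_tendsto_norm (x : BoundedNet U E) :
    ∃ r, Tendsto (fun i => ‖x.1 i‖) U (𝓝 r) := by
  obtain ⟨R, hR⟩ := x.2
  obtain ⟨r, -, hr⟩ := (isCompact_Icc (a := (0 : ℝ)) (b := R)).ultrafilter_le_nhds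
    (U.map fun i => ‖x.1 i‖) (by
      rw [le_principal_iff]
      exact hR.mono fun i hi => ⟨norm_nonneg _, hi⟩)
  exact ⟨r, hr⟩

/-- The limit of the norms. -/
noncomputable def BoundedNet.limNorm (x : BoundedNet U E) : ℝ := x.exists_tendsto_norm.choose

theorem BoundedNet.tendsto_limNorm (x : BoundedNet U E) :
    Tendsto (fun i => ‖x.1 i‖) U (𝓝 x.limNorm) := x.exists_tendsto_norm.choose_spec

/-- The limit of the norms as a seminorm. -/
noncomputable def BoundedNet.seminorm : Seminorm ℝ (BoundedNet U E) :=
  Seminorm.of BoundedNet.limNorm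
    (fun x x' => le_of_tendsto_of_tendsto' (x + x').tendsto_limNorm
      (x.tendsto_limNorm.add x'.tendsto_limNorm) fun _ => norm_add_le _ _)
    (fun a x => tendsto_nhds_unique (a • x).tendsto_limNorm (by
      refine (x.tendsto_limNorm.const_mul ‖a‖).congr fun i => ?_
      exact (norm_smul a (x.1 i)).symm))

noncomputable instance : SeminormedAddCommGroup (BoundedNet U E) :=
  BoundedNet.seminorm.toAddGroupSeminorm.toSeminormedAddCommGroup

theorem BoundedNet.tendsto_norm (x : BoundedNet U E) :
    Tendsto (fun i => ‖x.1 i‖) U (𝓝 ‖x‖) := x.tendsto_limNorm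

noncomputable instance : NormedSpace ℝ (BoundedNet U E) where
  norm_smul_le a x := (map_smul_eq_mul BoundedNet.seminorm a x).le

theorem BoundedNet.tendsto_dist (x x' : BoundedNet U E) :
    Tendsto (fun i => dist (x.1 i) (x'.1 i)) U (𝓝 (dist x x')) := by
  simp only [dist_eq_norm]
  exact (x - x').tendsto_norm

end Ultraproduct

/-- A surjective isometry from a seminormed space to a normed space that preserves zero is
linear. -/
theorem isometry_map_linear {V F : Type*} [SeminormedAddCommGroup V] [NormedSpace ℝ V]
    [NormedAddCommGroup F] [NormedSpace ℝ F] {T : V → F} (hT : Isometry T)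
    (hs : Function.Surjective T) (h0 : T 0 = 0) (a b : ℝ) (x x' : V) :
    T (a • x + b • x') = a • T x + b • T x' := by
  -- On the separation quotient `T` becomes a bijective isometry of normed spaces, to which
  -- Mazur-Ulam applies.
  let T' : SeparationQuotient V → F := SeparationQuotient.lift T fun v w h => by
    rw [← dist_eq_zero, hT.dist_eq]
    exact Metric.inseparable_iff.1 h
  have hT' : Isometry T' := by
    refine Isometry.of_dist_eq fun v w => ?_
    obtain ⟨v, rfl⟩ := SeparationQuotient.surjective_mk v
    obtain ⟨w, rfl⟩ := SeparationQuotient.surjective_mk w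
    rw [SeparationQuotient.dist_mk]
    exact hT.dist_eq v w
  have hs' : Function.Surjective T' := fun f => by
    obtain ⟨v, rfl⟩ := hs f
    exact ⟨SeparationQuotient.mk v, rfl⟩
  let e : SeparationQuotient V ≃ᵢ F := ⟨Equiv.ofBijective T' ⟨hT'.injective, hs'⟩, hT'⟩
  let l := e.toRealLinearIsometryEquivOfMapZero h0
  exact (map_add l (a • SeparationQuotient.mk x) (b • SeparationQuotient.mk x')).trans
    (congrArg₂ (· + ·) (map_smul l a (SeparationQuotient.mk x))
      (map_smul l b (SeparationQuotient.mk x')))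

/-! ### Linearity of Gromov-Hausdorff convergence of normed spaces -/

section LinearTargets

variable {I : Type*} [Preorder I]

theorem IsRealizingEmbedding.exists_tendsto {Y : I → Type*} [∀ i, MetricSpace (Y i)]
    {Z : Type*} [MetricSpace Z] {y : ∀ i, Y i} {z : Z} {ψ : ∀ i, Y i → Z}
    {B : Type*} [NormedAddCommGroup B] {α : ∀ i, Y i → B} {αl : Z → B}
    (hψ : IsPointedGHApprox y z ψ) (hα : IsRealizingEmbedding y ψ α αl) (s : Z) :
    ∃ t : ∀ i, Y i, Tendsto (fun i => α i (t i)) atTop (𝓝 (αl s)) := by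
  obtain ⟨ρ, hρ⟩ := hψ.exists_tendsto_nat
  have hinf : Tendsto (fun i => Metric.infDist (αl s) (range (α i))) atTop (𝓝 0) := by
    refine Metric.tendsto_nhds.2 fun ε hε => ?_
    filter_upwards [hα.eventually_infDist_le_infDist hψ ‖αl s‖ (half_pos hε)] with i hi
    have h1 := hi (αl s) le_rfl
    rw [Metric.infDist_zero_of_mem (mem_range_self s)] at h1
    rw [Real.dist_0_eq_abs, abs_of_nonneg Metric.infDist_nonneg]
    linarith
  have h1 : ∀ i, ∃ t : Y i, dist (αl s) (α i t) <
      Metric.infDist (αl s) (range (α i)) + 1 / ((ρ i : ℝ) + 1) := fun i => by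
    obtain ⟨_, ⟨t, rfl⟩, ht⟩ := (Metric.infDist_lt_iff (⟨_, mem_range_self (y i)⟩ :
      (range (α i)).Nonempty)).1 (show Metric.infDist (αl s) (range (α i)) <
        Metric.infDist (αl s) (range (α i)) + 1 / ((ρ i : ℝ) + 1) from
          lt_add_of_pos_right _ Nat.one_div_pos_of_nat)
    exact ⟨t, ht⟩
  choose t ht using h1
  refine ⟨t, tendsto_iff_dist_tendsto_zero.2 ?_⟩
  refine squeeze_zero (fun _ => dist_nonneg) (fun i => ?_)
    (g := fun i => Metric.infDist (αl s) (range (α i)) + 1 / ((ρ i : ℝ) + 1)) ?_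
  · rw [dist_comm]
    exact (ht i).le
  · simpa using hinf.add ((tendsto_one_div_add_atTop_nhds_zero_nat (𝕜 := ℝ)).comp hρ)

/-- The points `ψ i (t i)` stay in a closed ball of the proper space `Z`, hence converge along the
ultrafilter, and their images under `αl` are asymptotic to the given net. -/
theorem IsRealizingEmbedding.exists_tendsto_ultrafilter {Y : I → Type*} [∀ i, MetricSpace (Y i)]
    {Z : Type*} [MetricSpace Z] [ProperSpace Z] {y : ∀ i, Y i} {z : Z} {ψ : ∀ i, Y i → Z}
    {B : Type*} [NormedAddCommGroup B] {α : ∀ i, Y i → B} {αl : Z → B}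
    (hψ : IsPointedGHApprox y z ψ) (hα : IsRealizingEmbedding y ψ α αl) {U : Ultrafilter I}
    (hU : (U : Filter I) ≤ atTop) {t : ∀ i, Y i} {R : ℝ}
    (ht : ∀ᶠ i in (U : Filter I), ‖α i (t i)‖ ≤ R) :
    ∃ s : Z, Tendsto (fun i => α i (t i)) U (𝓝 (αl s)) := by
  have hclose : Tendsto (fun i => dist (α i (t i)) (αl (ψ i (t i)))) U (𝓝 0) := by
    refine Metric.tendsto_nhds.2 fun ε hε => ?_
    filter_upwards [ht, hU (hα.eventually_close hψ R hε)] with i h1 h2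
    rw [Real.dist_0_eq_abs, abs_of_nonneg dist_nonneg, dist_eq_norm]
    exact h2 _ h1
  obtain ⟨s, -, hs⟩ := (isCompact_closedBall z (R + 1 + ‖αl z‖)).ultrafilter_le_nhds
    (U.map fun i => ψ i (t i)) (by
      rw [le_principal_iff]
      change ∀ᶠ i in (U : Filter I), ψ i (t i) ∈ Metric.closedBall z (R + 1 + ‖αl z‖)
      filter_upwards [ht, hclose.eventually_lt_const one_pos] with i h1 h2
      rw [Metric.mem_closedBall, ← hα.isometry_lim.dist_eq, dist_eq_norm]
      rw [dist_eq_norm] at h2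
      linarith [norm_sub_le (αl (ψ i (t i))) (αl z),
        norm_le_insert (α i (t i)) (αl (ψ i (t i)))])
  have hs' : Tendsto (fun i => ψ i (t i)) U (𝓝 s) := hs
  refine ⟨s, ((hα.isometry_lim.continuous.tendsto s).comp hs').congr_dist ?_⟩
  exact hclose.congr fun i => dist_comm _ _

variable {E : I → Type*} [∀ i, NormedAddCommGroup (E i)] [∀ i, NormedSpace ℝ (E i)]
  {F : Type*} [NormedAddCommGroup F] [NormedSpace ℝ F] [ProperSpace F]
  {y : ∀ i, E i} {z : F} {ψ : ∀ i, E i → F}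
  {B : Type*} [NormedAddCommGroup B] {α : ∀ i, E i → B} {αl : F → B}

/-- It suffices to argue along each ultrafilter finer than `atTop`. There `T`, the limit of the
embedded net, is defined on all bounded nets, isometric because each `α i` is, surjective by
`exists_tendsto`, and zero at zero by `h0`; hence it is linear. -/
theorem IsRealizingEmbedding.tendsto_linear (hψ : IsPointedGHApprox y z ψ)
    (hα : IsRealizingEmbedding y ψ α αl)
    (h0 : Tendsto (fun i => α i 0) atTop (𝓝 (αl 0))) {x x' : ∀ i, E i} {f f' : F}
    (hx : Tendsto (fun i => α i (x i)) atTop (𝓝 (αl f)))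
    (hx' : Tendsto (fun i => α i (x' i)) atTop (𝓝 (αl f'))) (a b : ℝ) :
    Tendsto (fun i => α i (a • x i + b • x' i)) atTop (𝓝 (αl (a • f + b • f'))) := by
  refine (tendsto_iff_ultrafilter _ _ _).2 fun U hU => ?_
  have hlim : ∀ v : BoundedNet U E, ∃ s : F, Tendsto (fun i => α i (v.1 i)) U (𝓝 (αl s)) := by
    rintro ⟨v, R, hR⟩
    refine hα.exists_tendsto_ultrafilter hψ hU (R := R + (‖αl 0‖ + 1)) ?_
    filter_upwards [hR, hU (h0.norm.eventually_lt_const (lt_add_one _))] with i h1 h2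
    have h3 := norm_le_insert (α i 0) (α i (v i))
    rw [← dist_eq_norm, (hα.isometry i).dist_eq, dist_zero_left] at h3
    exact h3.trans (by linarith [h1, h2])
  have hbdd : ∀ {v : ∀ i, E i} {s : F}, Tendsto (fun i => α i (v i)) U (𝓝 (αl s)) →
      v ∈ boundedNets U E := by
    intro v s hv
    refine ⟨‖αl s‖ + 1 + (‖αl 0‖ + 1), ?_⟩
    filter_upwards [hv.norm.eventually_lt_const (lt_add_one _),
      hU (h0.norm.eventually_lt_const (lt_add_one _))] with i h1 h2
    rw [← dist_zero_right, ← (hα.isometry i).dist_eq, dist_eq_norm]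
    linarith [norm_sub_le (α i (v i)) (α i 0)]
  choose T hT using hlim
  have huniq : ∀ (v : BoundedNet U E) (s : F), Tendsto (fun i => α i (v.1 i)) U (𝓝 (αl s)) →
      T v = s := fun v s hv => hα.isometry_lim.injective (tendsto_nhds_unique (hT v) hv)
  have hiso : Isometry T := Isometry.of_dist_eq fun v w => by
    refine tendsto_nhds_unique ?_ (v.tendsto_dist w)
    rw [← hα.isometry_lim.dist_eq]
    simpa only [(hα.isometry _).dist_eq] using (hT v).dist (hT w)
  have hsurj : Function.Surjective T := fun s => by
    obtain ⟨t, ht⟩ := hα.exists_tendsto hψ s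
    exact ⟨⟨t, hbdd (ht.mono_left hU)⟩, huniq _ s (ht.mono_left hU)⟩
  let v : BoundedNet U E := ⟨x, hbdd (hx.mono_left hU)⟩
  let v' : BoundedNet U E := ⟨x', hbdd (hx'.mono_left hU)⟩
  have key := isometry_map_linear hiso hsurj (huniq 0 0 (h0.mono_left hU)) a b v v'
  rw [huniq v f (hx.mono_left hU), huniq v' f' (hx'.mono_left hU)] at key
  rw [← key]
  exact hT (a • v + b • v')

/-- There are linear maps from the limit space that converge to the identity, uniformly on compact
sets. -/
theorem IsRealizingEmbedding.exists_linear (hψ : IsPointedGHApprox y z ψ)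
    (hα : IsRealizingEmbedding y ψ α αl)
    (h0 : Tendsto (fun i => α i 0) atTop (𝓝 (αl 0))) :
    ∃ L : ∀ i, F →L[ℝ] E i, ∀ K : Set F, IsCompact K → ∀ η > 0, ∀ᶠ i in atTop,
      ∀ f ∈ K, ‖α i (L i f) - αl f‖ < η := by
  have hfin : FiniteDimensional ℝ F := FiniteDimensional.of_locallyCompactSpace ℝ
  let b := Module.finBasis ℝ F
  choose e he using fun k => hα.exists_tendsto hψ (b k)
  -- `F` is finite-dimensional, so `L i` may send a basis to vectors `e k i` converging to it;
  -- `tendsto_linear` then gives pointwise convergence.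
  let L : ∀ i, F →L[ℝ] E i := fun i => LinearMap.toContinuousLinearMap (b.constr ℝ fun k => e k i)
  have hL : ∀ i f, L i f = ∑ k, b.repr f k • e k i := fun i f => b.constr_apply_fintype ℝ _ f
  have hpt : ∀ f, Tendsto (fun i => α i (L i f)) atTop (𝓝 (αl f)) := by
    intro f
    have h1 : ∀ s : Finset (Fin (Module.finrank ℝ F)),
        Tendsto (fun i => α i (∑ k ∈ s, b.repr f k • e k i)) atTop
          (𝓝 (αl (∑ k ∈ s, b.repr f k • b k))) := by
      classical
      intro s
      induction s using Finset.induction_on with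
      | empty => simpa using h0
      | insert k s hk ih =>
        simp only [Finset.sum_insert hk]
        simpa only [one_smul] using hα.tendsto_linear hψ h0 (he k) ih (b.repr f k) 1
    have h2 := h1 Finset.univ
    rw [b.sum_repr] at h2
    simpa only [hL] using h2
  have hnorm : ∀ k, ∀ᶠ i in atTop, ‖e k i‖ ≤ ‖b k‖ + 1 := by
    intro k
    have h1 := (he k).dist h0
    simp only [(hα.isometry _).dist_eq, hα.isometry_lim.dist_eq, dist_zero_right] at h1
    filter_upwards [h1.eventually_lt_const (lt_add_one _)] with i hi
    exact hi.le
  -- A Lipschitz constant valid for all `L i` with `i` large; with it pointwise convergence becomes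
  -- uniform on compact sets.
  let C : ℝ := ∑ k, ‖LinearMap.toContinuousLinearMap (b.coord k)‖ * (‖b k‖ + 1)
  have hC0 : 0 ≤ C := Finset.sum_nonneg fun k _ => by positivity
  have hlip : ∀ᶠ i in atTop, ∀ f, ‖L i f‖ ≤ C * ‖f‖ := by
    filter_upwards [eventually_all.2 hnorm] with i hi f
    rw [hL, Finset.sum_mul]
    refine (norm_sum_le _ _).trans (Finset.sum_le_sum fun k _ => ?_)
    rw [norm_smul]
    have h1 : ‖b.repr f k‖ ≤ ‖LinearMap.toContinuousLinearMap (b.coord k)‖ * ‖f‖ :=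
      (LinearMap.toContinuousLinearMap (b.coord k)).le_opNorm f
    calc ‖b.repr f k‖ * ‖e k i‖
        ≤ ‖LinearMap.toContinuousLinearMap (b.coord k)‖ * ‖f‖ * (‖b k‖ + 1) :=
          mul_le_mul h1 (hi k) (norm_nonneg _) (by positivity)
      _ = _ := by ring
  refine ⟨L, fun K hK η hη => ?_⟩
  have hδ : 0 < η / (2 * (C + 2)) := by positivity
  obtain ⟨t, -, htf, htK⟩ := hK.finite_cover_balls hδ
  have hfin : ∀ᶠ i in atTop, ∀ g ∈ t, dist (α i (L i g)) (αl g) < η / 2 :=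
    (eventually_all_finite htf).2 fun g _ =>
      (tendsto_iff_dist_tendsto_zero.1 (hpt g)).eventually_lt_const (half_pos hη)
  filter_upwards [hfin, hlip] with i h1 h2 f hf
  obtain ⟨g, hg, hfg⟩ := mem_iUnion₂.1 (htK hf)
  rw [Metric.mem_ball] at hfg
  have h3 := dist_triangle4 (α i (L i f)) (α i (L i g)) (αl g) (αl f)
  rw [(hα.isometry i).dist_eq, hα.isometry_lim.dist_eq, dist_comm g f] at h3
  have h4 : dist (L i f) (L i g) ≤ C * dist f g := by
    rw [dist_eq_norm, dist_eq_norm, ← map_sub]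
    exact h2 _
  have h5 : (C + 2) * dist f g < η / 2 := by
    have := mul_lt_mul_of_pos_left hfg (show 0 < C + 2 by positivity)
    refine this.trans_eq ?_
    field_simp
  rw [← dist_eq_norm]
  have h6 := h1 g hg
  have h7 : 0 ≤ dist f g := dist_nonneg
  linarith

end LinearTargets

/-! ### Linearity of the `L^p`-topology for Banach targets -/

section LinearPullback

variable {I : Type*} [Preorder I] {M : I → Type*} [∀ i, MeasurableSpace (M i)]
  {N : Type*} [TopologicalSpace N] [MeasurableSpace N] [PolishSpace N] [BorelSpace N]
  {μ : ∀ i, Measure (M i)} {ν : Measure N} {φ : MeasureApprox μ ν} {p : ℝ≥0∞} [Fact (1 ≤ p)]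
  {E : I → Type*} [∀ i, NormedAddCommGroup (E i)] {F : Type*} [NormedAddCommGroup F]
  [∀ i, NormedSpace ℝ (E i)] [NormedSpace ℝ F]
  {h0 : ∀ i, AEStronglyMeasurable (0 : M i → E i) (μ i)}

/-- Linearity holds only eventually, since `pullbackLp` is replaced by zero where the pull-back
fails to be in `L^p`. -/
theorem MeasureApprox.eventually_pullbackLp_linear (hp : p ≠ ∞) (a b : ℝ)
    (w w' : C_c(N, F)) :
    ∀ᶠ i in atTop, φ.pullbackLp p i (a • w + b • w') =
      a • φ.pullbackLp p i w + b • φ.pullbackLp p i w' := by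
  have hp0 : p ≠ 0 := (zero_lt_one.trans_le (Fact.out : 1 ≤ p)).ne'
  filter_upwards [φ.eventually_memLp_pullback hp0 hp w, φ.eventually_memLp_pullback hp0 hp w',
    φ.eventually_memLp_pullback hp0 hp (a • w + b • w')] with i h1 h2 h3
  refine Lp.ext ?_
  filter_upwards [φ.coeFn_pullbackLp h1, φ.coeFn_pullbackLp h2, φ.coeFn_pullbackLp h3,
    Lp.coeFn_add (a • φ.pullbackLp p i w) (b • φ.pullbackLp p i w'),
    Lp.coeFn_smul a (φ.pullbackLp p i w), Lp.coeFn_smul b (φ.pullbackLp p i w')]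
    with x hx1 hx2 hx3 hx4 hx5 hx6
  rw [hx3, hx4, Pi.add_apply, hx5, hx6, Pi.smul_apply, Pi.smul_apply, hx1, hx2]
  by_cases hx : x ∈ φ.dom i
  · simp [pullback_of_mem hx]
  · simp [pullback_of_notMem hx]

/-- The image under linear maps of the pull-back of a compactly supported map. -/
noncomputable def linearPullback (φ : MeasureApprox μ ν) (p : ℝ≥0∞) [Fact (1 ≤ p)]
    (h0 : ∀ i, AEStronglyMeasurable (0 : M i → E i) (μ i)) (L : ∀ i, F →L[ℝ] E i) (i : I)
    (w : C_c(N, F)) : LpMap p (μ i) (0 : M i → E i) (h0 i) :=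
  LpMap.equivLp.symm ((L i).compLpL p (μ i) (φ.pullbackLp p i w))

theorem eventually_linearPullback_linear (hp : p ≠ ∞) (L : ∀ i, F →L[ℝ] E i) (a b : ℝ)
    (w w' : C_c(N, F)) :
    ∀ᶠ i in atTop, linearPullback φ p h0 L i (a • w + b • w') =
      a • linearPullback φ p h0 L i w + b • linearPullback φ p h0 L i w' := by
  filter_upwards [φ.eventually_pullbackLp_linear hp a b w w'] with i hi
  rw [linearPullback, hi, map_add, map_smul, map_smul]
  rfl

end LinearPullback

/-! ### Linear model nets for Banach targets -/

section LinearLp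

variable {I : Type*} [Preorder I] {M : I → Type*} [∀ i, MeasurableSpace (M i)]
  {N : Type*} [TopologicalSpace N] [MeasurableSpace N] [PolishSpace N] [LocallyCompactSpace N]
  [BorelSpace N] {μ : ∀ i, Measure (M i)} {ν : Measure N} [IsLocallyFiniteMeasure ν]
  {φ : MeasureApprox μ ν} {p : ℝ≥0∞} [Fact (1 ≤ p)]
  {E : I → Type*} [∀ i, NormedAddCommGroup (E i)] {F : Type*} [NormedAddCommGroup F]
  {B : Type*} [NormedAddCommGroup B] {α : ∀ i, E i → B} {αl : F → B}

/-- The defect has constant norm `‖α i 0 - αl 0‖` over the support of a cut-off, so this number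
times the norm of the pulled-back cut-off tends to zero. The latter norm has a positive limit
because the measure has full support. -/
theorem LocalBaseMapsConverge.tendsto_zero [ν.IsOpenPosMeasure] [Nonempty N] (hp : p ≠ ∞)
    (hb : LocalBaseMapsConverge p φ α αl (fun i => (0 : M i → E i)) (0 : N → F)) :
    Tendsto (fun i => α i 0) atTop (𝓝 (αl 0)) := by
  have hp0 : p ≠ 0 := (zero_lt_one.trans_le (Fact.out : 1 ≤ p)).ne'
  obtain ⟨x₀⟩ := ‹Nonempty N›
  obtain ⟨χ, hχ1, hχ⟩ := exists_cutoff (isCompact_singleton (x := x₀))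
  have hχm := memLp_compactlySupported (p := p) (ν := ν) χ
  have hχ0 : eLpNorm χ p ν ≠ 0 := by
    rw [Ne, eLpNorm_eq_zero_iff hχm.1 hp0]
    intro h
    have h1 := congrFun ((Continuous.ae_eq_iff_eq ν χ.continuous continuous_zero).1 h) x₀
    exact zero_ne_one (h1.symm.trans (hχ1 x₀ rfl))
  have h1 := ENNReal.Tendsto.div (hb _ χ.hasCompactSupport.isCompact) (Or.inr hχ0)
    (φ.tendsto_eLpNorm_pullback hp0 hp χ) (Or.inl hχm.2.ne)
  rw [ENNReal.zero_div] at h1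
  refine tendsto_iff_edist_tendsto_0.2 (tendsto_of_tendsto_of_tendsto_of_le_of_le'
    tendsto_const_nhds h1 (Eventually.of_forall fun _ => zero_le) ?_)
  filter_upwards [(φ.tendsto_eLpNorm_pullback hp0 hp χ).eventually_ne hχ0,
    φ.eventually_memLp_pullback hp0 hp χ] with i hi hm
  rw [ENNReal.le_div_iff_mul_le (Or.inl hi) (Or.inl hm.2.ne), edist_eq_enorm_sub]
  rw [← eLpNorm_norm, ← enorm_norm (α i 0 - αl 0), ← eLpNorm_const_smul]
  refine eLpNorm_mono fun x => ?_
  rw [Pi.smul_apply, norm_smul, norm_norm, norm_norm]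
  by_cases hx : x ∈ φ.preimage i (tsupport χ)
  · obtain ⟨hxd, hxC⟩ := hx
    rw [baseDefect_apply hxd hxC, MeasureApprox.pullback_of_mem hxd,
      Real.norm_of_nonneg (hχ _).1]
    exact mul_le_of_le_one_right (norm_nonneg _) (hχ _).2
  · rw [baseDefect, indicator_of_notMem hx]
    by_cases hxd : x ∈ φ.dom i
    · rw [MeasureApprox.pullback_of_mem hxd,
        image_eq_zero_of_notMem_tsupport fun hxC => hx ⟨hxd, hxC⟩]
      simp
    · rw [MeasureApprox.pullback_of_notMem hxd]
      simp

variable [∀ i, NormedSpace ℝ (E i)] [NormedSpace ℝ F]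

variable {h0 : ∀ i, AEStronglyMeasurable (0 : M i → E i) (μ i)}
  {hl : AEStronglyMeasurable (0 : N → F) ν}

/-- Pull-backs of compactly supported maps, composed with almost isometric linear maps, converge. -/
theorem lpConv_linearPullback (hp : p ≠ ∞) (hα : ∀ i, Isometry (α i)) (hαl : Isometry αl)
    {L : ∀ i, F →L[ℝ] E i}
    (hL : Nonempty N → ∀ K : Set F, IsCompact K → ∀ η > 0, ∀ᶠ i in atTop,
      ∀ f ∈ K, ‖α i (L i f) - αl f‖ < η) (w : C_c(N, F)) :
    φ.LpConv (fun i => LpMap.toLp (hα i) (linearPullback φ p h0 L i w))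
      (LpMap.toLp hαl (LpMap.equivLp.symm (compactlySupportedToLp ν p w) :
        LpMap p ν (0 : N → F) hl)) := by
  have hp0 : p ≠ 0 := (zero_lt_one.trans_le (Fact.out : 1 ≤ p)).ne'
  have hC := w.hasCompactSupport.isCompact
  obtain ⟨χ, hχ1, hχ⟩ := exists_cutoff hC
  let g : C_c(N, B) := ⟨⟨fun x => αl (w x) - αl 0,
    (hαl.continuous.comp w.continuous).sub continuous_const⟩,
    w.hasCompactSupport.comp_left (g := fun f => αl f - αl 0) (sub_self _)⟩
  rw [φ.lpConv_iff hp]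
  intro ε hε
  -- The same `g` serves for every `ε`, since its class is exactly the embedded limit.
  refine ⟨g, ?_, ?_⟩
  · rw [← edist_lt_ofReal, edist_compactlySupportedToLp]
    refine lt_of_le_of_lt (le_of_eq ?_) (ENNReal.ofReal_pos.2 hε)
    rw [eLpNorm_congr_ae (g := 0), eLpNorm_zero]
    filter_upwards [LpMap.coeFn_toLp hαl (LpMap.equivLp.symm (compactlySupportedToLp ν p w) :
      LpMap p ν (0 : N → F) hl), (memLp_compactlySupported (p := p) (ν := ν) w).coeFn_toLp]
      with x hx hx'
    rw [hx]
    change αl (w x) - αl 0 - (αl (compactlySupportedToLp ν p w x) - αl 0) = 0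
    rw [compactlySupportedToLp, hx', sub_self]
  · obtain ⟨η, hη, hηε⟩ := ENNReal.exists_nnreal_pos_mul_lt
      (memLp_compactlySupported (p := p) (ν := ν) χ).2.ne (ENNReal.ofReal_pos.2 hε).ne'
    have hη2 : 0 < (η : ℝ) / 2 := by positivity
    have hunif : ∀ᶠ i in atTop, ∀ t : N,
        ‖α i (L i (w t)) - αl (w t)‖ < η / 2 ∧ ‖α i 0 - αl 0‖ < η / 2 := by
      rcases isEmpty_or_nonempty N with hN | hN
      · exact Eventually.of_forall fun i t => isEmptyElim t
      -- Zero is added to control `α i 0` and the points outside the support of `w`.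
      · have hK : IsCompact (insert 0 (w '' tsupport w)) := (hC.image w.continuous).insert 0
        filter_upwards [hL hN _ hK _ hη2] with i hi t
        have h1 := hi 0 (mem_insert _ _)
        rw [map_zero] at h1
        refine ⟨hi _ ?_, h1⟩
        by_cases ht : t ∈ tsupport w
        · exact Or.inr (mem_image_of_mem _ ht)
        · exact Or.inl (image_eq_zero_of_notMem_tsupport ht)
    filter_upwards [hunif, φ.eventually_memLp_pullback hp0 hp w,
      φ.eventually_memLp_pullback hp0 hp g,
      (ENNReal.Tendsto.const_mul (φ.tendsto_eLpNorm_pullback hp0 hp χ)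
        (Or.inr (ENNReal.coe_ne_top (r := η)))).eventually_lt_const hηε] with i hi hw hg hχi
    rw [← edist_lt_ofReal, φ.edist_pullbackLp hg]
    refine lt_of_le_of_lt ?_ hχi
    have h1 := eLpNorm_le_mul_add (p := p) (κ := μ i)
      (u := fun x => LpMap.toLp (hα i) (linearPullback φ p h0 L i w) x - φ.pullback i g x)
      (f := (0 : M i → ℝ)) (g := φ.pullback i χ) 0 η aestronglyMeasurable_zero
      (φ.stronglyMeasurable_pullback χ.continuous.stronglyMeasurable).aestronglyMeasurable ?_
    · simpa using h1
    · filter_upwards [LpMap.coeFn_toLp (hα i) (linearPullback φ p h0 L i w),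
        (L i).coeFn_compLpL (φ.pullbackLp p i w), φ.coeFn_pullbackLp hw]
        with x hx1 hx2 hx3
      have hx4 : (linearPullback φ p h0 L i w).1 x = L i (φ.pullback i w x) := by
        rw [← hx3]
        exact hx2
      rw [hx1, hx4, NNReal.coe_zero, zero_mul, zero_add, Pi.zero_apply]
      by_cases hxd : x ∈ φ.dom i
      · rw [MeasureApprox.pullback_of_mem hxd, MeasureApprox.pullback_of_mem hxd,
          MeasureApprox.pullback_of_mem hxd]
        set t := φ.toFun i ⟨x, hxd⟩
        change ‖α i (L i (w t)) - α i 0 - (αl (w t) - αl 0)‖ ≤ _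
        by_cases ht : t ∈ tsupport w
        · rw [hχ1 t ht, norm_one, mul_one, sub_sub_sub_comm]
          refine (norm_sub_le _ _).trans ?_
          linarith [(hi t).1, (hi t).2]
        · rw [image_eq_zero_of_notMem_tsupport ht, map_zero, sub_self, sub_self, sub_self,
            norm_zero]
          positivity
      · rw [MeasureApprox.pullback_of_notMem hxd, MeasureApprox.pullback_of_notMem hxd, map_zero,
          sub_self, sub_self, norm_zero]
        positivity

theorem LpMap.dist_linear_le {M E : Type*} [MeasurableSpace M] [NormedAddCommGroup E]
    [NormedSpace ℝ E] {μ : Measure M} {h0 : AEStronglyMeasurable (0 : M → E) μ} (a b : ℝ)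
    (u u' v v' : LpMap p μ (0 : M → E) h0) :
    dist (a • u + b • v) (a • u' + b • v') ≤ |a| * dist u u' + |b| * dist v v' := by
  simp only [← LpMap.isometry_linearLp.dist_eq, map_add, map_smul]
  refine (dist_add_add_le _ _ _ _).trans_eq ?_
  rw [dist_smul₀, dist_smul₀, Real.norm_eq_abs, Real.norm_eq_abs]

/-- The limits are approximated by compactly supported `w` and `w'`. Distances to the linear model
nets converge, so `a • u i + b • v i` is eventually close to the model net of `a • w + b • w'`, and
so is any net `x` converging to `a • s + b • t`. Hence the two differ by a null net. -/
theorem lpConv_linear [NormedSpace ℝ B] [∀ i, ProperSpace (E i)] [ProperSpace F]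
    [ν.IsOpenPosMeasure] (hp : p ≠ ∞) {y : ∀ i, E i} {z : F} {ψ : ∀ i, E i → F}
    (hψ : IsPointedGHApprox y z ψ) (hα : IsRealizingEmbedding y ψ α αl)
    (hb : LocalBaseMapsConverge p φ α αl (fun i => (0 : M i → E i)) (0 : N → F)) (a b : ℝ)
    {u v : ∀ i, LpMap p (μ i) (0 : M i → E i) (h0 i)} {s t : LpMap p ν (0 : N → F) hl}
    (hu : φ.LpConv (fun i => LpMap.toLp (hα.isometry i) (u i)) (LpMap.toLp hα.isometry_lim s))
    (hv : φ.LpConv (fun i => LpMap.toLp (hα.isometry i) (v i)) (LpMap.toLp hα.isometry_lim t)) :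
    φ.LpConv (fun i => LpMap.toLp (hα.isometry i) (a • u i + b • v i))
      (LpMap.toLp hα.isometry_lim (a • s + b • t)) := by
  obtain ⟨ρ, hρ⟩ := hψ.exists_tendsto_nat
  have hconv := φ.isMetricConvergence_lpConv (B := B) (p := p) hp hρ
  obtain ⟨L, hL⟩ : ∃ L : ∀ i, F →L[ℝ] E i, Nonempty N → ∀ K : Set F, IsCompact K → ∀ η > 0,
      ∀ᶠ i in atTop, ∀ f ∈ K, ‖α i (L i f) - αl f‖ < η := by
    -- Over an empty `N` convergence of `α i 0` cannot be extracted from the base maps, but no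
    -- uniform closeness is required and zero maps suffice.
    rcases isEmpty_or_nonempty N with hN | hN
    · exact ⟨fun _ => 0, fun h => isEmptyElim h.some⟩
    · obtain ⟨L, hL⟩ := hα.exists_linear hψ (hb.tendsto_zero hp)
      exact ⟨L, fun _ => hL⟩
  let P : C_c(N, F) → LpMap p ν (0 : N → F) hl := fun w =>
    LpMap.equivLp.symm (compactlySupportedToLp ν p w)
  have happ : ∀ {x : ∀ i, LpMap p (μ i) (0 : M i → E i) (h0 i)} {r : LpMap p ν (0 : N → F) hl},
      φ.LpConv (fun i => LpMap.toLp (hα.isometry i) (x i)) (LpMap.toLp hα.isometry_lim r) →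
      ∀ {w : C_c(N, F)} {ε : ℝ}, dist r (P w) < ε →
        ∀ᶠ i in atTop, dist (x i) (linearPullback φ p h0 L i w) < ε := by
    intro x r hx w ε hw
    have h1 := hconv.tendsto_dist _ _ _ _ hx
      (lpConv_linearPullback (h0 := h0) (hl := hl) hp hα.isometry hα.isometry_lim hL w)
    simp only [(LpMap.isometry_toLp _).dist_eq] at h1
    exact h1.eventually_lt_const hw
  have hdense : ∀ (r : LpMap p ν (0 : N → F) hl) {δ : ℝ}, 0 < δ → ∃ w, dist r (P w) < δ := by
    intro r δ hδ
    obtain ⟨w, hw⟩ := (denseRange_compactlySupportedToLp hp).exists_dist_lt (LpMap.linearLp r) hδ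
    refine ⟨w, ?_⟩
    rw [← LpMap.isometry_linearLp.dist_eq]
    exact hw
  obtain ⟨x, hx⟩ := exists_lpConv_toLp hp hψ hα h0 (ξl := (0 : N → F)) continuous_zero hb
    (a • s + b • t)
  refine hconv.of_dist _ _ _ hx ?_
  simp only [(LpMap.isometry_toLp _).dist_eq]
  refine Metric.tendsto_nhds.2 fun ε hε => ?_
  set δ := ε / (2 * (|a| + |b| + 1)) with hδ
  have hδ0 : 0 < δ := by positivity
  have hδε : |a| * δ + |b| * δ < ε / 2 := by
    have h1 : (|a| + |b| + 1) * δ = ε / 2 := by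
      rw [hδ]
      field_simp
    linarith
  obtain ⟨w, hw⟩ := hdense s hδ0
  obtain ⟨w', hw'⟩ := hdense t hδ0
  have hP : P (a • w + b • w') = a • P w + b • P w' := rfl
  have hlin : ∀ {c d : ℝ}, c < δ → d < δ → |a| * c + |b| * d < ε / 2 := fun hc hd => by
    have h1 := mul_le_mul_of_nonneg_left hc.le (abs_nonneg a)
    have h2 := mul_le_mul_of_nonneg_left hd.le (abs_nonneg b)
    linarith
  have hst : dist (a • s + b • t) (P (a • w + b • w')) < ε / 2 := by
    rw [hP]
    exact (LpMap.dist_linear_le a b _ _ _ _).trans_lt (hlin hw hw')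
  filter_upwards [happ hx hst, happ hu hw, happ hv hw',
    eventually_linearPullback_linear (φ := φ) (h0 := h0) hp L a b w w'] with i h1 h2 h3 h4
  rw [Real.dist_0_eq_abs, abs_of_nonneg dist_nonneg]
  have h5 := (LpMap.dist_linear_le a b _ _ _ _).trans_lt (hlin h2 h3)
  rw [← h4] at h5
  have h6 := dist_triangle_right (x i) (a • u i + b • v i)
    (linearPullback φ p h0 L i (a • w + b • w'))
  linarith

end LinearLp

end AsympLp

theorem mainTheorem5
    {I : Type*} [Preorder I] [IsDirectedOrder I] [Nonempty I]
    {M : I → Type*} [∀ i, TopologicalSpace (M i)] [∀ i, PolishSpace (M i)]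
    [∀ i, LocallyCompactSpace (M i)] [∀ i, MeasurableSpace (M i)] [∀ i, BorelSpace (M i)]
    (μ : ∀ i, Measure (M i)) [∀ i, IsLocallyFiniteMeasure (μ i)]
    [∀ i, (μ i).IsOpenPosMeasure]
    {N : Type*} [TopologicalSpace N] [PolishSpace N] [LocallyCompactSpace N]
    [MeasurableSpace N] [BorelSpace N]
    (ν : Measure N) [IsLocallyFiniteMeasure ν] [ν.IsOpenPosMeasure]
    (p : ℝ≥0∞) [Fact (1 ≤ p)] (hp : p ≠ ∞)
    (φ : MeasureApprox μ ν) :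
    (∀ (Y : I → Type*) [∀ i, MetricSpace (Y i)] [∀ i, ProperSpace (Y i)]
      (Z : Type*) [MetricSpace Z] [ProperSpace Z]
      (y : ∀ i, Y i) (z : Z) (ψ : ∀ i, Y i → Z) (_ : IsPointedGHApprox y z ψ)
      (B : Type*) [NormedAddCommGroup B] [NormedSpace ℝ B] [CompleteSpace B]
      [TopologicalSpace.SeparableSpace B]
      (α : ∀ i, Y i → B) (αl : Z → B) (hα : IsRealizingEmbedding y ψ α αl)
      (ξ : ∀ i, M i → Y i) (hξ : ∀ i, AEStronglyMeasurable (ξ i) (μ i))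
      (ξl : N → Z) (hξl : Continuous ξl) (_ : BaseMapsConverge p φ α αl ξ ξl),
      (∀ φ' : MeasureApprox μ ν, φ.Equivalent φ' →
        lpTopology p φ' hα.isometry hα.isometry_lim hξ hξl.aestronglyMeasurable =
          lpTopology p φ hα.isometry hα.isometry_lim hξ hξl.aestronglyMeasurable) ∧
      (∀ (B' : Type*) [NormedAddCommGroup B'] [NormedSpace ℝ B'] [CompleteSpace B']
        [TopologicalSpace.SeparableSpace B']
        (β : ∀ i, Y i → B') (βl : Z → B') (hβ : IsRealizingEmbedding y ψ β βl),
        lpTopology p φ hβ.isometry hβ.isometry_lim hξ hξl.aestronglyMeasurable =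
          lpTopology p φ hα.isometry hα.isometry_lim hξ hξl.aestronglyMeasurable) ∧
      IsAsymptoticRelation
        (lpTopology p φ hα.isometry hα.isometry_lim hξ hξl.aestronglyMeasurable) ∧
      IsClosed[lpTopologyBanach B p φ] (range (unionEmbedding p hα.isometry hα.isometry_lim hξ
        (hξl.aestronglyMeasurable (μ := ν))))) ∧
    (∀ (E : I → Type*) [∀ i, NormedAddCommGroup (E i)] [∀ i, NormedSpace ℝ (E i)]
      [∀ i, ProperSpace (E i)]
      (F : Type*) [NormedAddCommGroup F] [NormedSpace ℝ F] [ProperSpace F]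
      (y : ∀ i, E i) (z : F) (ψ : ∀ i, E i → F) (_ : IsPointedGHApprox y z ψ)
      (B : Type*) [NormedAddCommGroup B] [NormedSpace ℝ B] [CompleteSpace B]
      [TopologicalSpace.SeparableSpace B]
      (α : ∀ i, E i → B) (αl : F → B) (hα : IsRealizingEmbedding y ψ α αl)
      (_ : BaseMapsConverge p φ α αl (fun i => (0 : M i → E i)) (0 : N → F)),
      IsLinearAsymptoticRelation
        (lpTopology p φ hα.isometry hα.isometry_lim
          (ξ := fun i => (0 : M i → E i)) (ξl := (0 : N → F))
          (fun _ => aestronglyMeasurable_zero) aestronglyMeasurable_zero)) := by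
  refine ⟨?_, ?_⟩
  · intro Y _ _ Z _ _ y z ψ hψ B _ _ _ _ α αl hα ξ hξ ξl hξl hbase
    have hb := hbase.localBaseMapsConverge
    refine ⟨fun φ' hφ' => ?_, fun B' _ _ _ _ β βl hβ => ?_, ?_, ?_⟩
    -- Both topologies are restrictions, under the same embedding, of ambient Banach-valued
    -- topologies that already coincide.
    · rw [lpTopology, lpTopology, hφ'.lpTopologyBanach_eq hp]
    · exact lpTopology_eq_of_realizing hp hψ hα hβ hξ hξl hb
    · exact isAsymptoticRelation_lpTopology hp hψ hα hξ hξl hb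
    · exact isClosed_range_unionEmbedding hp hψ hα hξ hξl hb
  · intro E _ _ _ F _ _ _ y z ψ hψ B _ _ _ _ α αl hα hbase
    have hb := hbase.localBaseMapsConverge
    obtain ⟨ρ, hρ⟩ := hψ.exists_tendsto_nat
    have key : ∀ (x : ∀ i, LpMap p (μ i) (0 : M i → E i) aestronglyMeasurable_zero)
        (xl : LpMap p ν (0 : N → F) aestronglyMeasurable_zero),
        ConvergesIn (lpTopology p φ hα.isometry hα.isometry_lim
          (ξ := fun i => (0 : M i → E i)) (ξl := (0 : N → F))
          (fun _ => aestronglyMeasurable_zero) aestronglyMeasurable_zero) x xl ↔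
        φ.LpConv (fun i => LpMap.toLp (hα.isometry i) (x i))
          (LpMap.toLp hα.isometry_lim xl) := fun x xl =>
      convergesIn_induced_iff (φ.isMetricConvergence_lpConv hp hρ)
    exact ⟨isAsymptoticRelation_lpTopology hp hψ hα _ continuous_zero hb,
      fun a b x x' xl xl' hx hx' => (key _ _).2
        (lpConv_linear hp hψ hα hb a b ((key _ _).1 hx) ((key _ _).1 hx'))⟩
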